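/- Let $p\ge 5$ be a prime, let $R_p=\widehat{\mathbb Z}_p^{ur}=W(\overline{\mathbb F}_p)$ with its Frobenius lift $\phi$, let $\pi$ be a root of an Eisenstein polynomial of degree $e\ge 2$ over $\mathbb Z_p$, and let $R_\pi=R_p[\pi]$, with $\phi$ extended to $R_\pi$ by $\phi(\pi)=\pi$. Put $\delta_p x=(\phi(x)-x^p)/p$ on $R_p$ and $\delta_\pi x=(\phi(x)-x^p)/\pi$ on $R_\pi$. Let $X$ be a smooth $R_p$-scheme and $X_{R_\pi}=X\otimes_{R_p}R_\pi$. For $X=\mathrm{Spec}\,A$ affine let $\mathcal O(J^n_p(X))$ (respectively $\mathcal O(J^n_\pi(X_{R_\pi}))$) be the $p$-adic completion of the $n$-th term of the universal $\delta_p$-prolongation sequence of $A$ over $R_p$ (respectively of the universal $\delta_\pi$-prolongation sequence of $A\otimes_{R_p}R_\pi$ over $R_\pi$); that is, if $A=R_p[x]/I$, the completion of $R_p[x,\delta_px,\dots,\delta_p^nx]/(I,\delta_pI,\dots,\delta_p^nI)$, and similarly for $\pi$. For general $X$ these rings are the global functions on the formal schemes glued from the affine pieces. Since $\mathcal O(J_p^\bullet(X))\otimes_{R_p}R_\pi$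 is a $\delta_\pi$-prolongation sequence, universality gives a canonical homomorphism $$\iota_n:\mathcal O(J^n_\pi(X_{R_\pi}))\to \mathcal O(J^n_p(X))\otimes_{R_p}R_\pi .$$ A function $f\in\mathcal O(J^n_p(X))$ is called $\delta_\pi$-overconvergent if $p^\nu f$ is in the image of $\iota_n$ for some integer $\nu\ge 0$. (When $\mathbb Q_p(\pi)/\mathbb Q_p$ is Galois, this is equivalent to: $p^\nu f$ is in the image of $(1\otimes \mathrm{Tr}_{R_\pi/R_p})\circ\iota_n$ for some $\nu\ge 0$.) Let $\partial$ be an $R_p$-derivation of $\mathcal O_X$ and $r\ge 0$. There are unique $R_p$-derivations $\partial_0,\dots,\partial_r$ of $\mathcal O_{J^r_p(X)}$, the conjugate operators of $\partial$, such that on functions on (affine open subsets of) $X$ one has $\partial_j\circ\phi^s=0$ for $s\ne j$ and $\partial_j\circ\phi^j=p^j\cdot\phi^j\circ\partial$, for all $s,j\in\{0,\dots,r\}$. If $f\in\mathcal O(J^r_p(X))$ is $\delta_\pi$-overconvergent, then so are $\partial_jf$ for $j=0,\dots,r$ (with either of the two forms of overconvergence). Moreover, if $r=1$, then the $R_\pi$-linear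 extensions of $\partial_0$ and $\partial_1$ to $\mathcal O(J^1_p(X))\otimes_{R_p}R_\pi$ send the image of $\mathcal O(J^1_\pi(X_{R_\pi}))$ under $\iota_1$ into itself. -/

import Mathlib

open AlgebraicGeometry
open scoped nonZeroDivisors TensorProduct

noncomputable section

namespace ArithJet

/-! ### The base rings -/

/-- A ring `R` with an element `ϖ` that is not a zero divisor and divides `p`, and with a ring
endomorphism `φ` that lifts the `p`-power Frobenius modulo `ϖ`. The Fermat quotient map of `R` is
`x ↦ (φ x - x ^ p) / ϖ`. Only the two instances below are used. -/
class FrobeniusBase (p : ℕ) (R : Type*) [CommRing R] where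
  phi : R →+* R
  unif : R
  unif_mem : unif ∈ R⁰
  unif_dvd : unif ∣ (p : R)
  dvd_phi_sub : ∀ x, unif ∣ phi x - x ^ p

/-- The completion of the maximal unramified extension of `ℤ_p`: the Witt vectors of an algebraic
closure of `𝔽_p`. -/
abbrev Rp (p : ℕ) [Fact p.Prime] : Type := WittVector p (AlgebraicClosure (ZMod p))

/-- The inclusion of `ℤ_p = W(𝔽_p)` into `Rp p`. -/
def padicToRp (p : ℕ) [Fact p.Prime] : ℤ_[p] →+* Rp p :=
  (WittVector.map (algebraMap (ZMod p) (AlgebraicClosure (ZMod p)))).comp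
    (WittVector.equiv p).symm.toRingHom

theorem frobenius_padicToRp (p : ℕ) [Fact p.Prime] (x : ℤ_[p]) :
    WittVector.frobenius (padicToRp p x) = padicToRp p x := by
  ext n
  simp only [padicToRp, RingHom.comp_apply]
  rw [WittVector.coeff_frobenius_charP, WittVector.map_coeff, ← map_pow]
  simp

instance (p : ℕ) [Fact p.Prime] : FrobeniusBase p (Rp p) where
  phi := WittVector.frobenius
  unif := p
  unif_mem := mem_nonZeroDivisors_of_ne_zero (WittVector.irreducible p).ne_zero
  unif_dvd := dvd_rfl
  dvd_phi_sub x := by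
    rw [← Ideal.mem_span_singleton, WittVector.mem_span_p_iff_coeff_zero_eq_zero]
    change WittVector.constantCoeff (WittVector.frobenius x - x ^ p) = 0
    rw [map_sub, map_pow]
    change (WittVector.frobenius x).coeff 0 - x.coeff 0 ^ p = 0
    rw [WittVector.coeff_frobenius_charP, sub_self]

/-- An Eisenstein polynomial of degree at least two over `ℤ_p`. -/
structure EisensteinPoly (p : ℕ) [Fact p.Prime] where
  poly : Polynomial ℤ_[p]
  monic : poly.Monic
  eisenstein : poly.IsEisensteinAt (Ideal.span {(p : ℤ_[p])})
  two_le : 2 ≤ poly.natDegree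

theorem dvd_phi_sub_add {p : ℕ} [Fact p.Prime] {S T : Type*} [CommRing S] [CommRing T] (f g : S →+* T) {w : T}
    (hw : w ∣ (p : T)) {x y : S} (hx : w ∣ f x - g x ^ p) (hy : w ∣ f y - g y ^ p) :
    w ∣ f (x + y) - g (x + y) ^ p := by
  obtain ⟨r, hr⟩ := exists_add_pow_prime_eq (Fact.out : p.Prime) (g x) (g y)
  rw [map_add, map_add, hr]
  have h3 : w ∣ (p : T) * g x * g y * r := by
    rw [mul_assoc, mul_assoc]; exact hw.mul_right _
  have := (hx.add hy).sub h3
  convert this using 1; ring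

theorem dvd_phi_sub_mul {p : ℕ} {S T : Type*} [CommRing S] [CommRing T] (f g : S →+* T) {w : T}
    {x y : S} (hx : w ∣ f x - g x ^ p) (hy : w ∣ f y - g y ^ p) :
    w ∣ f (x * y) - g (x * y) ^ p := by
  have := (hx.mul_right (f y)).add (hy.mul_left (g x ^ p))
  convert this using 1
  rw [map_mul, map_mul]; ring

section Ramified

open Polynomial

variable {p : ℕ} [Fact p.Prime]

/-- The ring `R_π = R_p[π]`, where `π` is a root of the given Eisenstein polynomial. -/
abbrev Rpi (E : EisensteinPoly p) : Type := AdjoinRoot (E.poly.map (padicToRp p))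

namespace Rpi

variable (E : EisensteinPoly p)

/-- The uniformizer `π`. -/
def pi : Rpi E := AdjoinRoot.root _

/-- The endomorphism of `R_π` that extends the Frobenius of `R_p` and fixes `π`. -/
def phi : Rpi E →+* Rpi E :=
  AdjoinRoot.lift ((AdjoinRoot.of _).comp WittVector.frobenius) (pi E) (by
    rw [eval₂_map, RingHom.comp_assoc]
    have : (WittVector.frobenius : Rp p →+* Rp p).comp (padicToRp p) = padicToRp p :=
      RingHom.ext (frobenius_padicToRp p)
    rw [this, ← eval₂_map]
    exact AdjoinRoot.eval₂_root _)

theorem phi_algebraMap (x : Rp p) :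
    phi E (algebraMap (Rp p) (Rpi E) x) = algebraMap (Rp p) (Rpi E) (FrobeniusBase.phi p x) :=
  AdjoinRoot.lift_of _

theorem phi_pi : phi E (pi E) = pi E := AdjoinRoot.lift_root _

theorem exists_coeff_zero : ∃ u : ℤ_[p]ˣ, E.poly.coeff 0 = p * u := by
  have h := E.eisenstein.mem (n := 0) (by have := E.two_le; omega)
  obtain ⟨u, hu⟩ := Ideal.mem_span_singleton.1 h
  have hun : IsUnit u := by
    by_contra hn
    have : u ∈ IsLocalRing.maximalIdeal ℤ_[p] := hn
    rw [PadicInt.maximalIdeal_eq_span_p] at this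
    apply E.eisenstein.notMem
    rw [hu, pow_two]
    exact Ideal.mul_mem_mul (Ideal.mem_span_singleton_self _) this
  exact ⟨hun.unit, hu⟩

theorem pi_dvd : pi E ∣ (p : Rpi E) := by
  obtain ⟨u, hu⟩ := exists_coeff_zero E
  set f : ℤ_[p] →+* Rpi E := (AdjoinRoot.of _).comp (padicToRp p) with hf
  have h0 : E.poly.eval₂ f (pi E) = 0 := by
    rw [hf, ← eval₂_map]; exact AdjoinRoot.eval₂_root _
  have h2 := congrArg (eval₂ f (pi E)) (divX_mul_X_add E.poly)
  rw [h0, eval₂_add, eval₂_mul, eval₂_X, eval₂_C, hu, map_mul, map_natCast] at h2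
  have h1 : pi E ∣ (p : Rpi E) * f u :=
    ⟨-(E.poly.divX.eval₂ f (pi E)), by linear_combination h2⟩
  exact (Units.dvd_mul_right (u := Units.map (f : ℤ_[p] →* Rpi E) u)).1 h1

theorem pi_mem : pi E ∈ (Rpi E)⁰ := by
  rw [mem_nonZeroDivisors_iff_right]
  intro x hx
  obtain ⟨g, rfl⟩ := AdjoinRoot.mk_surjective x
  rw [pi, ← AdjoinRoot.mk_X, ← map_mul, AdjoinRoot.mk_eq_zero] at hx
  obtain ⟨h, hh⟩ := hx
  have hE : (E.poly.map (padicToRp p)).coeff 0 ≠ 0 := by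
    obtain ⟨u, hu⟩ := exists_coeff_zero E
    rw [coeff_map, hu, map_mul, map_natCast]
    exact mul_ne_zero (WittVector.irreducible p).ne_zero (u.isUnit.map (padicToRp p)).ne_zero
  have h0 : h.coeff 0 = 0 := by
    have := congrArg (fun q => coeff q 0) hh
    simp only [mul_coeff_zero, coeff_X_zero, mul_zero] at this
    exact (mul_eq_zero.1 this.symm).resolve_left hE
  obtain ⟨k, rfl⟩ := X_dvd_iff.2 h0
  rw [AdjoinRoot.mk_eq_zero]
  refine ⟨k, ?_⟩
  have hX : (X : (Rp p)[X]) ≠ 0 := X_ne_zero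
  apply mul_right_cancel₀ hX
  rw [hh]; ring

end Rpi

instance (E : EisensteinPoly p) : FrobeniusBase p (Rpi E) where
  phi := Rpi.phi E
  unif := Rpi.pi E
  unif_mem := Rpi.pi_mem E
  unif_dvd := Rpi.pi_dvd E
  dvd_phi_sub x := by
    have hC : ∀ a : Rp p, Rpi.pi E ∣ Rpi.phi E (AdjoinRoot.of _ a) - (AdjoinRoot.of _ a) ^ p := by
      intro a
      rw [show Rpi.phi E (AdjoinRoot.of _ a) = AdjoinRoot.of _ (WittVector.frobenius a) from
        AdjoinRoot.lift_of _, ← map_pow, ← map_sub]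
      obtain ⟨b, hb⟩ := FrobeniusBase.dvd_phi_sub (p := p) a
      change WittVector.frobenius a - a ^ p = p * b at hb
      rw [hb, map_mul, map_natCast]
      exact (Rpi.pi_dvd E).mul_right _
    have hX : Rpi.pi E ∣ Rpi.phi E (Rpi.pi E) - Rpi.pi E ^ p := by
      rw [Rpi.phi_pi]
      exact dvd_sub dvd_rfl (dvd_pow_self _ (Fact.out : p.Prime).ne_zero)
    obtain ⟨g, rfl⟩ := AdjoinRoot.mk_surjective x
    induction g using Polynomial.induction_on with
    | C a => exact hC a
    | add f g hf hg =>
      rw [map_add]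
      exact dvd_phi_sub_add (Rpi.phi E) (RingHom.id _) (Rpi.pi_dvd E) hf hg
    | monomial n a ih =>
      rw [pow_succ, ← mul_assoc, map_mul]
      exact dvd_phi_sub_mul (Rpi.phi E) (RingHom.id _) ih hX

end Ramified

/-! ### Polynomials in the variables `x, δ x, …, δⁿ x` -/

/-- The ring `R[x, δ x, …, δⁿ x]`, where `x = (x_a)` is a family of variables indexed by `ι`; the
variable `(i, a)` is `δⁱ x_a`. -/
abbrev JetPoly (R : Type*) [CommRing R] (ι : Type*) (n : ℕ) : Type _ :=
  MvPolynomial (Fin (n + 1) × ι) R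

namespace JetPoly

open MvPolynomial

/-- The inclusion `R[x, …, δⁿ x] → R[x, …, δⁿ⁺¹ x]`. -/
def incl (R : Type*) [CommRing R] (ι : Type*) (n : ℕ) :
    JetPoly R ι n →ₐ[R] JetPoly R ι (n + 1) :=
  rename (fun v => (v.1.castSucc, v.2))

section

variable (p : ℕ) {R : Type*} [CommRing R] [FrobeniusBase p R] (ι : Type*)

/-- The ring homomorphism `R[x, …, δⁿ x] → R[x, …, δⁿ⁺¹ x]` that is `φ` on `R` and sends `δⁱ x_a`
to `(δⁱ x_a) ^ p + t * δⁱ⁺¹ x_a`. For `t = ϖ` the symbols `δⁱ x_a` are the iterated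
`ϖ`-derivatives of `x_a`. -/
def frob (t : R) (n : ℕ) : JetPoly R ι n →+* JetPoly R ι (n + 1) :=
  eval₂Hom (C.comp (FrobeniusBase.phi p))
    (fun v => X (v.1.castSucc, v.2) ^ p + C t * X (v.1.succ, v.2))

end

theorem unif_cancel {p : ℕ} {R : Type*} [CommRing R] [FrobeniusBase p R] {σ : Type*} {x y : MvPolynomial σ R}
    (h : C (FrobeniusBase.unif p : R) * x = C (FrobeniusBase.unif p : R) * y) : x = y := by
  ext m
  have := congrArg (coeff m) h
  rw [coeff_C_mul, coeff_C_mul] at this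
  exact (mul_cancel_left_mem_nonZeroDivisors (FrobeniusBase.unif_mem (p := p))).1 this

section

variable {p : ℕ} [Fact p.Prime] {R : Type*} [CommRing R] [FrobeniusBase p R] {ι : Type*}

theorem dvd_frob_sub {t : R} (ht : FrobeniusBase.unif p ∣ t) (n : ℕ) (x : JetPoly R ι n) :
    C (FrobeniusBase.unif p : R) ∣ frob p ι t n x - incl R ι n x ^ p := by
  have hp : C (FrobeniusBase.unif p : R) ∣ ((p : ℕ) : JetPoly R ι (n + 1)) := by
    have := map_dvd (C : R →+* JetPoly R ι (n + 1)) (FrobeniusBase.unif_dvd (p := p) (R := R))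
    rwa [map_natCast] at this
  obtain ⟨g, hg⟩ : ∃ g : JetPoly R ι n →+* JetPoly R ι (n + 1), ∀ x, incl R ι n x = g x :=
    ⟨(incl R ι n).toRingHom, fun _ => rfl⟩
  have hgC : ∀ a, g (C a) = C a := fun a => by rw [← hg]; simp [incl]
  have hgX : ∀ v, g (X v) = X (v.1.castSucc, v.2) := fun v => by rw [← hg]; simp [incl]
  have hfC : ∀ a, frob p ι t n (C a) = C (FrobeniusBase.phi p a) := fun a => by simp [frob]
  have hfX : ∀ v, frob p ι t n (X v) = X (v.1.castSucc, v.2) ^ p + C t * X (v.1.succ, v.2) :=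
    fun v => by simp [frob]
  rw [hg]
  generalize frob p ι t n = f at hfC hfX
  induction x using MvPolynomial.induction_on with
  | C a =>
    rw [hfC, hgC, ← map_pow, ← map_sub]
    exact map_dvd _ (FrobeniusBase.dvd_phi_sub a)
  | add x y hx hy => exact dvd_phi_sub_add f g hp hx hy
  | mul_X x v hx =>
    refine dvd_phi_sub_mul f g hx ?_
    rw [hfX, hgX, add_sub_cancel_left]
    exact (map_dvd _ ht).mul_right _

/-- The `ϖ`-derivation `x ↦ (frob x - x ^ p) / ϖ`. -/
def delta {t : R} (ht : FrobeniusBase.unif p ∣ t) (n : ℕ) (x : JetPoly R ι n) :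
    JetPoly R ι (n + 1) :=
  (dvd_frob_sub ht n x).choose

theorem unif_mul_delta {t : R} (ht : FrobeniusBase.unif p ∣ t) (n : ℕ) (x : JetPoly R ι n) :
    C (FrobeniusBase.unif p : R) * delta ht n x = frob p ι t n x - incl R ι n x ^ p :=
  (dvd_frob_sub ht n x).choose_spec.symm

end

end JetPoly

/-! ### Prolongations and jet algebras -/

section Jets

variable (p : ℕ) [Fact p.Prime] (R : Type*) [CommRing R] [FrobeniusBase p R]

/-- The ideal of relations among `x, δ x, …, δⁿ x` for the tautological generators
`x = (x_b)_{b ∈ B}` of the `R`-algebra `B`: for `n = 0` all relations that hold in `B`, and in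
each further step the old relations together with their `ϖ`-derivatives. -/
def jetIdeal (B : Type*) [CommRing B] [Algebra R B] : ∀ n : ℕ, Ideal (JetPoly R B n)
  | 0 => RingHom.ker (MvPolynomial.aeval (fun v => v.2) : JetPoly R B 0 →ₐ[R] B)
  | n + 1 => Ideal.span
      ((JetPoly.incl R B n '' (jetIdeal B n : Set (JetPoly R B n))) ∪
        (JetPoly.delta (p := p) (dvd_refl (FrobeniusBase.unif p : R)) n ''
          (jetIdeal B n : Set (JetPoly R B n))))

/-- The `n`-th term `Bⁿ` of the universal prolongation sequence of the `R`-algebra `B`. -/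
def JetAlg (B : Type*) [CommRing B] [Algebra R B] (n : ℕ) : Type _ :=
  JetPoly R B n ⧸ jetIdeal p R B n

instance (B : Type*) [CommRing B] [Algebra R B] (n : ℕ) : CommRing (JetAlg p R B n) :=
  inferInstanceAs (CommRing (JetPoly R B n ⧸ jetIdeal p R B n))

instance (B : Type*) [CommRing B] [Algebra R B] (n : ℕ) : Algebra R (JetAlg p R B n) :=
  inferInstanceAs (Algebra R (JetPoly R B n ⧸ jetIdeal p R B n))

/-- The projection `R[x, …, δⁿ x] → Bⁿ`. -/
def JetAlg.mk (B : Type*) [CommRing B] [Algebra R B] (n : ℕ) :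
    JetPoly R B n →ₐ[R] JetAlg p R B n :=
  Ideal.Quotient.mkₐ R (jetIdeal p R B n)

/-- The ring of functions of the `n`-th jet space of `Spec B`: the `p`-adic completion of `Bⁿ`. -/
def JetRing (B : Type*) [CommRing B] [Algebra R B] (n : ℕ) : Type _ :=
  AdicCompletion (Ideal.span {(p : JetAlg p R B n)}) (JetAlg p R B n)

instance (B : Type*) [CommRing B] [Algebra R B] (n : ℕ) : CommRing (JetRing p R B n) :=
  inferInstanceAs (CommRing (AdicCompletion _ (JetAlg p R B n)))

instance (B : Type*) [CommRing B] [Algebra R B] (n : ℕ) : Algebra R (JetRing p R B n) :=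
  inferInstanceAs (Algebra R (AdicCompletion _ (JetAlg p R B n)))

/-- The canonical map `Bⁿ → (Bⁿ)^`. -/
def JetRing.of (B : Type*) [CommRing B] [Algebra R B] (n : ℕ) :
    JetAlg p R B n →ₐ[R] JetRing p R B n where
  toRingHom := algebraMap (JetAlg p R B n) (AdicCompletion _ (JetAlg p R B n))
  commutes' _ := rfl

/-- The element `φˢ b` of `R[x, …, δʳ x]`, for `s ≤ r`. -/
def JetPoly.phiPow {B : Type*} : ∀ r : ℕ, ℕ → B → JetPoly R B r
  | 0, _, b => MvPolynomial.X (0, b)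
  | r + 1, 0, b => JetPoly.incl R B r (JetPoly.phiPow r 0 b)
  | r + 1, s + 1, b =>
    JetPoly.frob p B (FrobeniusBase.unif p : R) r (JetPoly.phiPow r s b)

/-- The map `φˢ : B → O(Jʳ(Spec B))`, for `s ≤ r`. -/
def JetRing.phiPow {B : Type*} [CommRing B] [Algebra R B] (r s : ℕ) (b : B) : JetRing p R B r :=
  JetRing.of p R B r (JetAlg.mk p R B r (JetPoly.phiPow p R r s b))

variable {R}

section Map

variable {B B' : Type*} [CommRing B] [Algebra R B] [CommRing B'] [Algebra R B']

/-- The `R`-algebra homomorphism with `δⁱ x_b ↦ δⁱ x_{h b}`. -/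
def JetPoly.map (h : B →ₐ[R] B') (n : ℕ) : JetPoly R B n →ₐ[R] JetPoly R B' n :=
  MvPolynomial.rename (fun v => (v.1, h v.2))

theorem JetPoly.map_incl (h : B →ₐ[R] B') (n : ℕ) (x : JetPoly R B n) :
    JetPoly.map h (n + 1) (JetPoly.incl R B n x) = JetPoly.incl R B' n (JetPoly.map h n x) := by
  simp only [JetPoly.map, JetPoly.incl, MvPolynomial.rename_rename]
  rfl

theorem JetPoly.map_frob {p : ℕ} {R : Type*} [CommRing R] [FrobeniusBase p R] {B B' : Type*}
    [CommRing B] [Algebra R B] [CommRing B'] [Algebra R B'] (h : B →ₐ[R] B') (t : R) (n : ℕ) (x : JetPoly R B n) :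
    JetPoly.map h (n + 1) (JetPoly.frob p B t n x) =
      JetPoly.frob p B' t n (JetPoly.map h n x) := by
  induction x using MvPolynomial.induction_on with
  | C a => simp [JetPoly.map, JetPoly.frob]
  | add f g hf hg => simp only [map_add, hf, hg]
  | mul_X f v hf =>
    rw [map_mul, map_mul, map_mul, map_mul, hf]
    congr 1
    simp [JetPoly.map, JetPoly.frob]

theorem JetPoly.map_delta (h : B →ₐ[R] B') {t : R} (ht : FrobeniusBase.unif p ∣ t) (n : ℕ)
    (x : JetPoly R B n) :
    JetPoly.map h (n + 1) (JetPoly.delta ht n x) = JetPoly.delta ht n (JetPoly.map h n x) := by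
  apply JetPoly.unif_cancel (p := p)
  rw [JetPoly.unif_mul_delta, ← JetPoly.map_frob, ← JetPoly.map_incl, ← map_pow, ← map_sub,
    ← JetPoly.unif_mul_delta ht, map_mul]
  congr 1
  simp [JetPoly.map]

theorem jetIdeal_map (h : B →ₐ[R] B') (n : ℕ) :
    ∀ x ∈ jetIdeal p R B n, JetPoly.map h n x ∈ jetIdeal p R B' n := by
  induction n with
  | zero =>
    intro x hx
    have key : (MvPolynomial.aeval (fun v => v.2) : JetPoly R B' 0 →ₐ[R] B').comp
        (JetPoly.map h 0) = h.comp (MvPolynomial.aeval (fun v => v.2)) := by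
      ext v; simp [JetPoly.map]
    have hx' : (MvPolynomial.aeval (fun v => v.2) : JetPoly R B 0 →ₐ[R] B) x = 0 := hx
    change (MvPolynomial.aeval (fun v => v.2) : JetPoly R B' 0 →ₐ[R] B') (JetPoly.map h 0 x) = 0
    have := DFunLike.congr_fun key x
    rw [AlgHom.comp_apply, AlgHom.comp_apply, hx', map_zero] at this
    exact this
  | succ n ih =>
    intro x hx
    have : jetIdeal p R B (n + 1) ≤
        (jetIdeal p R B' (n + 1)).comap (JetPoly.map h (n + 1)) := by
      refine Ideal.span_le.2 ?_
      rintro _ (⟨y, hy, rfl⟩ | ⟨y, hy, rfl⟩)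
      · refine Ideal.subset_span (Or.inl ⟨_, ih y hy, ?_⟩)
        exact (JetPoly.map_incl h n y).symm
      · refine Ideal.subset_span (Or.inr ⟨_, ih y hy, ?_⟩)
        exact (JetPoly.map_delta p h _ n y).symm
    exact this hx

/-- Functoriality of `B ↦ Bⁿ`. -/
def JetAlg.map (h : B →ₐ[R] B') (n : ℕ) : JetAlg p R B n →ₐ[R] JetAlg p R B' n :=
  Ideal.quotientMapₐ (jetIdeal p R B' n) (JetPoly.map h n) (jetIdeal_map p h n)

end Map

/-- A ring homomorphism modulo powers of `p`. -/
def modPow {S T : Type*} [CommRing S] [CommRing T] (f : S →+* T) (m : ℕ) :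
    S ⧸ Ideal.span {(p : S)} ^ m →+* T ⧸ Ideal.span {(p : T)} ^ m :=
  Ideal.quotientMap _ f (by
    rw [← Ideal.map_le_iff_le_comap, Ideal.map_pow, Ideal.map_span, Set.image_singleton,
      map_natCast])

theorem factorPow_modPow (p : ℕ) {S T : Type*} [CommRing S] [CommRing T] (f : S →+* T) {m n : ℕ}
    (hle : m ≤ n) (x : AdicCompletion (Ideal.span {(p : S)}) S) :
    Ideal.Quotient.factorPow (Ideal.span {(p : T)}) hle
      (modPow p f n (AdicCompletion.evalₐ (Ideal.span {(p : S)}) n x)) =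
        modPow p f m (AdicCompletion.evalₐ (Ideal.span {(p : S)}) m x) := by
  have h1 : modPow p f m (AdicCompletion.evalₐ (Ideal.span {(p : S)}) m x) =
      modPow p f m (Ideal.Quotient.factorPow (Ideal.span {(p : S)}) hle
        (AdicCompletion.evalₐ (Ideal.span {(p : S)}) n x)) := by
    congr 1
    obtain ⟨y, rfl⟩ := AdicCompletion.mk_surjective _ _ x
    rw [AdicCompletion.evalₐ_mk, AdicCompletion.evalₐ_mk]
    exact (AdicCompletion.Ideal.mk_eq_mk _ hle y).symm
  rw [h1]
  generalize AdicCompletion.evalₐ (Ideal.span {(p : S)}) n x = z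
  obtain ⟨z, rfl⟩ := Ideal.Quotient.mk_surjective z
  rfl

/-- The homomorphism between `p`-adic completions induced by a ring homomorphism. -/
def completionMap {S T : Type*} [CommRing S] [CommRing T] (f : S →+* T) :
    AdicCompletion (Ideal.span {(p : S)}) S →+* AdicCompletion (Ideal.span {(p : T)}) T :=
  AdicCompletion.liftRingHom _
    (fun m => (modPow p f m).comp
      (AdicCompletion.evalₐ (Ideal.span {(p : S)}) m : AdicCompletion _ S →+* _))
    (fun hle => RingHom.ext fun x => factorPow_modPow p f hle x)

/-- The homomorphism induced by `f` on the `p`-adic completion of `S` when `T` is `p`-adically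
complete. -/
def completionLift {S T : Type*} [CommRing S] [CommRing T]
    [IsAdicComplete (Ideal.span {(p : T)}) T] (f : S →+* T) :
    AdicCompletion (Ideal.span {(p : S)}) S →+* T :=
  IsAdicComplete.liftRingHom (Ideal.span {(p : T)})
    (fun m => (modPow p f m).comp
      (AdicCompletion.evalₐ (Ideal.span {(p : S)}) m : AdicCompletion _ S →+* _))
    (fun hle => RingHom.ext fun x => factorPow_modPow p f hle x)

/-- Functoriality of `B ↦ O(Jⁿ(Spec B))`. -/
def JetRing.map {B B' : Type*} [CommRing B] [Algebra R B] [CommRing B'] [Algebra R B']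
    (h : B →ₐ[R] B') (n : ℕ) : JetRing p R B n →+* JetRing p R B' n :=
  completionMap p (JetAlg.map p h n : JetAlg p R B n →+* JetAlg p R B' n)

end Jets

/-! ### The comparison between `π`-jets and `p`-jets -/

/-- An extension `R → R'` of base rings such as `R_p → R_π`: `R'` is free of finite rank over `R`,
the endomorphism `φ` of `R'` extends that of `R`, and the distinguished element of `R` is `p`. -/
class FrobeniusExt (p : ℕ) (R R' : Type*) [CommRing R] [CommRing R'] [Algebra R R']
    [FrobeniusBase p R] [FrobeniusBase p R'] : Prop where
  phi_algebraMap : ∀ x : R, FrobeniusBase.phi p (algebraMap R R' x) =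
    algebraMap R R' (FrobeniusBase.phi p x)
  unif_eq : (FrobeniusBase.unif p : R) = p
  free : Module.Free R R'
  finite : Module.Finite R R'

instance {p : ℕ} [Fact p.Prime] (E : EisensteinPoly p) : FrobeniusExt p (Rp p) (Rpi E) where
  phi_algebraMap := Rpi.phi_algebraMap E
  unif_eq := rfl
  free := (E.monic.map (padicToRp p)).free_adjoinRoot
  finite := (E.monic.map (padicToRp p)).finite_adjoinRoot

section Compare

open JetPoly

variable (p : ℕ) [Fact p.Prime] (R R' : Type*) [CommRing R] [CommRing R'] [Algebra R R']
  [FrobeniusBase p R] [FrobeniusBase p R'] (A : Type*) [CommRing A] [Algebra R A]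

theorem aeval_surjective : Function.Surjective
    (MvPolynomial.aeval (fun v => v.2) : JetPoly R A 0 →ₐ[R] A) :=
  fun a => ⟨MvPolynomial.X (0, a), MvPolynomial.aeval_X _ _⟩

/-- The isomorphism `A⁰ ≃ A`. -/
def JetAlg.zeroEquiv : JetAlg p R A 0 ≃ₐ[R] A :=
  Ideal.quotientKerAlgEquivOfSurjective (aeval_surjective R A)

/-- The projection of `R'[x, δ_p x, …, δ_pⁿ x]` onto `R' ⊗ Aⁿ`, where `Aⁿ` is the `n`-th term of
the universal `δ_p`-prolongation sequence. -/
def mixedProj (n : ℕ) : JetPoly R' A n →ₐ[R'] R' ⊗[R] JetAlg p R A n :=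
  MvPolynomial.aeval (fun v => 1 ⊗ₜ JetAlg.mk p R A n (MvPolynomial.X v))

theorem mixedProj_algebraTensor (n : ℕ) (y : R' ⊗[R] JetPoly R A n) :
    mixedProj p R R' A n (MvPolynomial.algebraTensorAlgEquiv R R' y) =
      Algebra.TensorProduct.map (AlgHom.id R R') (JetAlg.mk p R A n) y := by
  have key : (mixedProj p R R' A n).comp
      (MvPolynomial.algebraTensorAlgEquiv (σ := Fin (n + 1) × A) R R').toAlgHom =
      Algebra.TensorProduct.map (AlgHom.id R' R') (JetAlg.mk p R A n) := by
    ext v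
    simp [mixedProj]
  exact DFunLike.congr_fun key y

theorem mixedProj_surjective (n : ℕ) : Function.Surjective (mixedProj p R R' A n) := by
  intro z
  have hs : Function.Surjective
      (Algebra.TensorProduct.map (AlgHom.id R R') (JetAlg.mk p R A n)) :=
    LinearMap.lTensor_surjective R' (g := (JetAlg.mk p R A n).toLinearMap)
      Ideal.Quotient.mk_surjective
  obtain ⟨y, rfl⟩ := hs z
  exact ⟨_, mixedProj_algebraTensor p R R' A n y⟩

theorem ker_mixedProj (n : ℕ) : RingHom.ker (mixedProj p R R' A n) =
    (jetIdeal p R A n).map (MvPolynomial.map (algebraMap R R')) := by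
  have hmap : ∀ f : JetPoly R A n, MvPolynomial.map (algebraMap R R') f =
      MvPolynomial.algebraTensorAlgEquiv R R' ((1 : R') ⊗ₜ[R] f) := by
    intro f; simp
  have hker : RingHom.ker (JetAlg.mk p R A n) = jetIdeal p R A n := Ideal.mk_ker
  apply le_antisymm
  · intro x hx
    obtain ⟨y, rfl⟩ := (MvPolynomial.algebraTensorAlgEquiv R R').surjective x
    have hy : y ∈ RingHom.ker
        (Algebra.TensorProduct.map (AlgHom.id R R') (JetAlg.mk p R A n)) := by
      rw [RingHom.mem_ker, ← mixedProj_algebraTensor]; exact hx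
    rw [Algebra.TensorProduct.lTensor_ker _ Ideal.Quotient.mk_surjective, hker] at hy
    suffices h : (jetIdeal p R A n).map Algebra.TensorProduct.includeRight ≤
        ((jetIdeal p R A n).map (MvPolynomial.map (algebraMap R R'))).comap
          (MvPolynomial.algebraTensorAlgEquiv (σ := Fin (n + 1) × A) R R') from h hy
    rw [Ideal.map_le_iff_le_comap]
    intro f hf
    rw [Ideal.mem_comap, Ideal.mem_comap, Algebra.TensorProduct.includeRight_apply, ← hmap]
    exact Ideal.mem_map_of_mem _ hf
  · rw [Ideal.map_le_iff_le_comap]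
    intro f hf
    rw [Ideal.mem_comap, RingHom.mem_ker, hmap, mixedProj_algebraTensor]
    rw [← hker, RingHom.mem_ker] at hf
    simp [hf]

variable {p R A}

theorem incl_mixed {R R' : Type*} [CommRing R] [CommRing R'] [Algebra R R'] {A : Type*} (n : ℕ) (f : JetPoly R A n) :
    incl R' A n (MvPolynomial.map (algebraMap R R') f) =
      MvPolynomial.map (algebraMap R R') (incl R A n f) := by
  simp only [incl, MvPolynomial.map_rename]

theorem frob_mixed [FrobeniusExt p R R'] (n : ℕ) (f : JetPoly R A n) :
    frob p A (p : R') n (MvPolynomial.map (algebraMap R R') f) =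
      MvPolynomial.map (algebraMap R R') (frob p A (FrobeniusBase.unif p : R) n f) := by
  induction f using MvPolynomial.induction_on with
  | C a => simp [frob, FrobeniusExt.phi_algebraMap]
  | add f g hf hg => simp only [map_add, hf, hg]
  | mul_X f v hf =>
    rw [map_mul, map_mul, map_mul, map_mul, hf]
    congr 1
    simp [frob, FrobeniusExt.unif_eq (p := p) (R := R) R']

theorem jetIdeal_incl (n : ℕ) {f : JetPoly R A n} (hf : f ∈ jetIdeal p R A n) :
    incl R A n f ∈ jetIdeal p R A (n + 1) :=
  Ideal.subset_span (Or.inl ⟨f, hf, rfl⟩)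

theorem jetIdeal_delta (n : ℕ) {f : JetPoly R A n} (hf : f ∈ jetIdeal p R A n) :
    delta (p := p) (dvd_refl (FrobeniusBase.unif p : R)) n f ∈ jetIdeal p R A (n + 1) :=
  Ideal.subset_span (Or.inr ⟨f, hf, rfl⟩)

theorem ker_mixedProj_incl (n : ℕ) {x : JetPoly R' A n}
    (hx : x ∈ RingHom.ker (mixedProj p R R' A n)) :
    incl R' A n x ∈ RingHom.ker (mixedProj p R R' A (n + 1)) := by
  rw [ker_mixedProj] at hx ⊢
  suffices h : (jetIdeal p R A n).map (MvPolynomial.map (algebraMap R R')) ≤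
      ((jetIdeal p R A (n + 1)).map (MvPolynomial.map (algebraMap R R'))).comap
        (incl R' A n) from h hx
  rw [Ideal.map_le_iff_le_comap]
  intro f hf
  rw [Ideal.mem_comap, Ideal.mem_comap, incl_mixed]
  exact Ideal.mem_map_of_mem _ (jetIdeal_incl n hf)

theorem delta_add_mem {S : Type*} [CommRing S] [FrobeniusBase p S] {ι : Type*} {t : S}
    (ht : FrobeniusBase.unif p ∣ t) (n : ℕ) (I : Ideal (JetPoly S ι (n + 1)))
    {x y : JetPoly S ι n} (hx : delta ht n x ∈ I) (hx' : incl S ι n x ∈ I)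
    (hy : delta ht n y ∈ I) : delta ht n (x + y) ∈ I := by
  obtain ⟨r, hr⟩ := exists_add_pow_prime_eq (Fact.out : p.Prime) (incl S ι n x) (incl S ι n y)
  obtain ⟨c, hc⟩ := FrobeniusBase.unif_dvd (p := p) (R := S)
  have hc' : ((p : ℕ) : JetPoly S ι (n + 1)) =
      MvPolynomial.C (FrobeniusBase.unif p : S) * MvPolynomial.C c := by
    rw [← map_mul, ← hc, map_natCast]
  have : delta ht n (x + y) = delta ht n x + delta ht n y -
      MvPolynomial.C c * incl S ι n y * r * incl S ι n x := by
    apply unif_cancel (p := p)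
    have h1 := unif_mul_delta ht n x
    have h2 := unif_mul_delta ht n y
    have h3 := unif_mul_delta ht n (x + y)
    rw [map_add, map_add, hr, hc'] at h3
    linear_combination h3 - h1 - h2
  rw [this]
  exact I.sub_mem (I.add_mem hx hy) (I.mul_mem_left _ hx')

theorem delta_mul_mem {S : Type*} [CommRing S] [FrobeniusBase p S] {ι : Type*} {t : S}
    (ht : FrobeniusBase.unif p ∣ t) (n : ℕ) (I : Ideal (JetPoly S ι (n + 1)))
    {x y : JetPoly S ι n} (hy : delta ht n y ∈ I) (hy' : incl S ι n y ∈ I) :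
    delta ht n (x * y) ∈ I := by
  have : delta ht n (x * y) = frob p ι t n x * delta ht n y +
      delta ht n x * incl S ι n y ^ p := by
    apply unif_cancel (p := p)
    have h1 := unif_mul_delta ht n x
    have h2 := unif_mul_delta ht n y
    have h3 := unif_mul_delta ht n (x * y)
    rw [map_mul, map_mul] at h3
    linear_combination h3 - frob p ι t n x * h2 - incl S ι n y ^ p * h1
  rw [this]
  exact I.add_mem (I.mul_mem_left _ hy)
    (I.mul_mem_left _ (I.pow_mem_of_mem hy' _ (Fact.out : p.Prime).pos))

theorem ker_mixedProj_delta [FrobeniusExt p R R'] (n : ℕ) {x : JetPoly R' A n}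
    (hx : x ∈ RingHom.ker (mixedProj p R R' A n)) :
    delta (p := p) (FrobeniusBase.unif_dvd (R := R')) n x ∈
      RingHom.ker (mixedProj p R R' A (n + 1)) := by
  rw [ker_mixedProj] at hx
  refine Submodule.span_induction
    (p := fun y _ => delta (p := p) (FrobeniusBase.unif_dvd (R := R')) n y ∈
      RingHom.ker (mixedProj p R R' A (n + 1))) ?_ ?_ ?_ ?_ hx
  · rintro _ ⟨f, hf, rfl⟩
    rw [ker_mixedProj]
    obtain ⟨c, hc⟩ := FrobeniusBase.unif_dvd (p := p) (R := R')
    have : delta (p := p) (FrobeniusBase.unif_dvd (R := R')) n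
        (MvPolynomial.map (algebraMap R R') f) =
        MvPolynomial.C c * MvPolynomial.map (algebraMap R R')
          (delta (p := p) (dvd_refl (FrobeniusBase.unif p : R)) n f) := by
      apply unif_cancel (p := p)
      have h1 := congrArg (MvPolynomial.map (algebraMap R R'))
        (unif_mul_delta (p := p) (dvd_refl (FrobeniusBase.unif p : R)) n f)
      have hu : (MvPolynomial.C (algebraMap R R' (FrobeniusBase.unif p)) : JetPoly R' A (n + 1)) =
          MvPolynomial.C (FrobeniusBase.unif p) * MvPolynomial.C c := by
        rw [FrobeniusExt.unif_eq (p := p) (R := R) R', map_natCast, hc, MvPolynomial.C_mul]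
      rw [map_mul, map_sub, map_pow, MvPolynomial.map_C, hu] at h1
      rw [unif_mul_delta, frob_mixed, incl_mixed, ← mul_assoc, h1]
    rw [this]
    exact Ideal.mul_mem_left _ _ (Ideal.mem_map_of_mem _ (jetIdeal_delta n hf))
  · have h0 : delta (p := p) (FrobeniusBase.unif_dvd (R := R')) n (0 : JetPoly R' A n) = 0 := by
      apply unif_cancel (p := p)
      rw [unif_mul_delta, map_zero, map_zero, zero_pow (Fact.out : p.Prime).ne_zero]
      simp
    rw [h0]; exact Ideal.zero_mem _
  · intro a b ha hb h1 h2
    exact delta_add_mem _ n _ h1 (ker_mixedProj_incl R' n (by rw [ker_mixedProj]; exact ha)) h2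
  · intro a b hb h1
    exact delta_mul_mem _ n _ h1 (ker_mixedProj_incl R' n (by rw [ker_mixedProj]; exact hb))

variable (p R A)

/-- A lift of an element of `R' ⊗ A` to `R'[x]`. -/
def mixedLift (b : R' ⊗[R] A) : JetPoly R' A 0 :=
  Function.surjInv (mixedProj_surjective p R R' A 0)
    (Algebra.TensorProduct.map (AlgHom.id R R')
      ((JetAlg.zeroEquiv p R A).symm : A →ₐ[R] JetAlg p R A 0) b)

/-- The element `δ_πⁱ b` of `R'[x, δ_p x, …, δ_pⁿ x]`, for `i ≤ n`, where `b` is lifted to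
`R'[x]` and `δ_π z = (φ z - z ^ p) / π`. -/
def mixedDeltaPow : ∀ n : ℕ, ℕ → R' ⊗[R] A → JetPoly R' A n
  | 0, _, b => mixedLift p R R' A b
  | n + 1, 0, b => incl R' A n (mixedDeltaPow n 0 b)
  | n + 1, i + 1, b =>
    delta (p := p) (FrobeniusBase.unif_dvd (R := R')) n (mixedDeltaPow n i b)

/-- The map `R'[x_b, δ_π x_b, …, δ_πⁿ x_b] → R'[x, δ_p x, …, δ_pⁿ x]`, with `b ∈ R' ⊗ A`, that
sends `δ_πⁱ x_b` to `δ_πⁱ b`. -/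
def comparePoly (n : ℕ) : JetPoly R' (R' ⊗[R] A) n →ₐ[R'] JetPoly R' A n :=
  MvPolynomial.aeval (fun v => mixedDeltaPow p R R' A n v.1 v.2)

theorem delta_incl {S : Type*} [CommRing S] [FrobeniusBase p S] {ι : Type*} {t : S}
    (ht : FrobeniusBase.unif p ∣ t) (n : ℕ) (x : JetPoly S ι n) :
    delta ht (n + 1) (incl S ι n x) = incl S ι (n + 1) (delta ht n x) := by
  apply unif_cancel (p := p)
  have hfi : frob p ι t (n + 1) (incl S ι n x) = incl S ι (n + 1) (frob p ι t n x) := by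
    induction x using MvPolynomial.induction_on with
    | C a => simp [frob, incl]
    | add f g hf hg => simp only [map_add, hf, hg]
    | mul_X f v hf =>
      rw [map_mul, map_mul, map_mul, map_mul, hf]
      congr 1
      simp [frob, incl]
  rw [unif_mul_delta, hfi, ← map_pow, ← map_sub, ← unif_mul_delta ht, map_mul]
  congr 1
  simp [incl]

theorem mixedDeltaPow_castSucc (n : ℕ) : ∀ (i : ℕ), i ≤ n → ∀ (b : R' ⊗[R] A),
    mixedDeltaPow p R R' A (n + 1) i b = incl R' A n (mixedDeltaPow p R R' A n i b) := by
  induction n with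
  | zero =>
    intro i hi b
    obtain rfl : i = 0 := by omega
    rfl
  | succ n ih =>
    rintro (_ | i) hi b
    · rfl
    · have h1 : mixedDeltaPow p R R' A (n + 1 + 1) (i + 1) b =
          delta (p := p) (FrobeniusBase.unif_dvd (R := R')) (n + 1)
            (mixedDeltaPow p R R' A (n + 1) i b) := rfl
      rw [h1, ih i (by omega), delta_incl]
      rfl

theorem comparePoly_incl (n : ℕ) (x : JetPoly R' (R' ⊗[R] A) n) :
    comparePoly p R R' A (n + 1) (incl R' _ n x) =
      incl R' A n (comparePoly p R R' A n x) := by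
  have : (comparePoly p R R' A (n + 1)).comp (incl R' _ n) =
      (incl R' A n).comp (comparePoly p R R' A n) := by
    ext v : 1
    simp only [comparePoly, incl, AlgHom.comp_apply, MvPolynomial.rename_X, MvPolynomial.aeval_X]
    exact mixedDeltaPow_castSucc p R R' A n v.1 (by omega) v.2
  exact DFunLike.congr_fun this x

theorem comparePoly_frob (n : ℕ) (x : JetPoly R' (R' ⊗[R] A) n) :
    comparePoly p R R' A (n + 1) (frob p _ (FrobeniusBase.unif p : R') n x) =
      frob p A (p : R') n (comparePoly p R R' A n x) := by
  induction x using MvPolynomial.induction_on with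
  | C a => simp [comparePoly, frob, MvPolynomial.algebraMap_eq]
  | add f g hf hg => simp only [map_add, hf, hg]
  | mul_X f v hf =>
    rw [map_mul, map_mul, map_mul, map_mul, hf]
    congr 1
    have h1 := unif_mul_delta (p := p) (FrobeniusBase.unif_dvd (R := R')) n
      (mixedDeltaPow p R R' A n v.1 v.2)
    have h2 : mixedDeltaPow p R R' A (n + 1) (v.1 + 1) v.2 =
      delta (p := p) (FrobeniusBase.unif_dvd (R := R')) n (mixedDeltaPow p R R' A n v.1 v.2) := rfl
    have h3 := mixedDeltaPow_castSucc p R R' A n v.1 (by omega) v.2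
    have h4 : comparePoly p R R' A n (MvPolynomial.X v) = mixedDeltaPow p R R' A n v.1 v.2 :=
      MvPolynomial.aeval_X _ _
    have h5 : frob p _ (FrobeniusBase.unif p : R') n (MvPolynomial.X v :
        JetPoly R' (R' ⊗[R] A) n) = MvPolynomial.X (v.1.castSucc, v.2) ^ p +
          MvPolynomial.C (FrobeniusBase.unif p : R') * MvPolynomial.X (v.1.succ, v.2) := by
      simp [frob]
    rw [h4, h5, map_add, map_pow, map_mul]
    have h6 : comparePoly p R R' A (n + 1) (MvPolynomial.X (v.1.castSucc, v.2)) =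
        mixedDeltaPow p R R' A (n + 1) v.1 v.2 := MvPolynomial.aeval_X _ _
    have h7 : comparePoly p R R' A (n + 1) (MvPolynomial.X (v.1.succ, v.2)) =
        mixedDeltaPow p R R' A (n + 1) (v.1 + 1) v.2 := MvPolynomial.aeval_X _ _
    have h8 : comparePoly p R R' A (n + 1) (MvPolynomial.C (FrobeniusBase.unif p : R')) =
        MvPolynomial.C (FrobeniusBase.unif p : R') := MvPolynomial.aeval_C _ _
    rw [h6, h7, h8, h3, h2, h1]
    ring

theorem comparePoly_delta (n : ℕ) (x : JetPoly R' (R' ⊗[R] A) n) :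
    comparePoly p R R' A (n + 1) (delta (dvd_refl (FrobeniusBase.unif p : R')) n x) =
      delta (p := p) (FrobeniusBase.unif_dvd (R := R')) n (comparePoly p R R' A n x) := by
  apply unif_cancel (p := p)
  rw [unif_mul_delta, ← comparePoly_frob, ← comparePoly_incl, ← map_pow, ← map_sub,
    ← unif_mul_delta (dvd_refl (FrobeniusBase.unif p : R')), map_mul]
  congr 1
  exact (MvPolynomial.aeval_C _ _).symm

theorem comparePoly_mem [FrobeniusExt p R R'] (n : ℕ) :
    ∀ x ∈ jetIdeal p R' (R' ⊗[R] A) n,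
      comparePoly p R R' A n x ∈ RingHom.ker (mixedProj p R R' A n) := by
  induction n with
  | zero =>
    intro x hx
    have key : (mixedProj p R R' A 0).comp (comparePoly p R R' A 0) =
        (Algebra.TensorProduct.map (AlgHom.id R' R')
          ((JetAlg.zeroEquiv p R A).symm : A →ₐ[R] JetAlg p R A 0)).comp
        (MvPolynomial.aeval (fun v => v.2)) := by
      ext v : 1
      simp only [comparePoly, AlgHom.comp_apply, MvPolynomial.aeval_X]
      exact Function.surjInv_eq (mixedProj_surjective p R R' A 0) _
    have hx' : (MvPolynomial.aeval (fun v => v.2) :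
      JetPoly R' (R' ⊗[R] A) 0 →ₐ[R'] R' ⊗[R] A) x = 0 := hx
    have := DFunLike.congr_fun key x
    rw [AlgHom.comp_apply, AlgHom.comp_apply, hx', map_zero] at this
    exact this
  | succ n ih =>
    intro x hx
    have : jetIdeal p R' (R' ⊗[R] A) (n + 1) ≤
        (RingHom.ker (mixedProj p R R' A (n + 1))).comap (comparePoly p R R' A (n + 1)) := by
      refine Ideal.span_le.2 ?_
      rintro _ (⟨y, hy, rfl⟩ | ⟨y, hy, rfl⟩)
      · rw [SetLike.mem_coe, Ideal.mem_comap]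
        rw [comparePoly_incl]
        exact ker_mixedProj_incl R' n (ih y hy)
      · rw [SetLike.mem_coe, Ideal.mem_comap]
        rw [comparePoly_delta]
        exact ker_mixedProj_delta R' n (ih y hy)
    exact this hx

/-- The canonical morphism `(R' ⊗ A)ⁿ → R' ⊗ Aⁿ` from the universal `δ_π`-prolongation sequence of
`R' ⊗ A` to the base change of the universal `δ_p`-prolongation sequence of `A`. -/
def compareAlg [FrobeniusExt p R R'] (n : ℕ) :
    JetAlg p R' (R' ⊗[R] A) n →ₐ[R'] R' ⊗[R] JetAlg p R A n :=
  Ideal.Quotient.liftₐ (jetIdeal p R' (R' ⊗[R] A) n)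
    ((mixedProj p R R' A n).comp (comparePoly p R R' A n)) (comparePoly_mem p R R' A n)

end Compare

/-! ### Completed tensor products -/

section Complete

theorem isAdicComplete_span_iff {p : ℕ} (S : Type*) [CommRing S] (M : Type*) [AddCommGroup M]
    [Module S M] : IsAdicComplete (Ideal.span {(p : S)}) M ↔
      (∀ x : M, (∀ n, ∃ y : M, x = p ^ n • y) → x = 0) ∧
      (∀ f : ℕ → M, (∀ m n, m ≤ n → ∃ y : M, f m - f n = p ^ m • y) →
        ∃ L, ∀ n, ∃ y : M, f n - L = p ^ n • y) := by
  have key : ∀ (n : ℕ) (x y : M),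
      x ≡ y [SMOD (Ideal.span {(p : S)} ^ n • ⊤ : Submodule S M)] ↔
        ∃ z : M, x - y = p ^ n • z := by
    intro n x y
    rw [SModEq.sub_mem, Ideal.span_singleton_pow, Submodule.ideal_span_singleton_smul,
      Submodule.mem_smul_pointwise_iff_exists]
    constructor
    · rintro ⟨z, -, hz⟩
      exact ⟨z, by rw [← hz, ← Nat.cast_pow, Nat.cast_smul_eq_nsmul]⟩
    · rintro ⟨z, hz⟩
      exact ⟨z, trivial, by rw [hz, ← Nat.cast_pow, Nat.cast_smul_eq_nsmul]⟩
  constructor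
  · intro h
    refine ⟨fun x hx => h.haus x fun n => (key n x 0).2 ?_, fun f hf => ?_⟩
    · simpa using hx n
    · obtain ⟨L, hL⟩ := h.prec (f := f) (fun {m n} hmn => (key m _ _).2 (hf m n hmn))
      exact ⟨L, fun n => (key n _ _).1 (hL n)⟩
  · rintro ⟨h1, h2⟩
    exact
      { haus' := fun x hx => h1 x fun n => by simpa using (key n x 0).1 (hx n)
        prec' := fun f hf => by
          obtain ⟨L, hL⟩ := h2 f fun m n hmn => (key m _ _).1 (hf hmn)
          exact ⟨L, fun n => (key n _ _).2 (hL n)⟩ }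

theorem isAdicComplete_tensor (p : ℕ) (R R' M : Type*) [CommRing R] [CommRing R'] [Algebra R R']
    [Module.Free R R'] [Module.Finite R R'] [CommRing M] [Algebra R M]
    (hM : IsAdicComplete (Ideal.span {(p : M)}) M) :
    IsAdicComplete (Ideal.span {(p : R' ⊗[R] M)}) (R' ⊗[R] M) := by
  classical
  rw [isAdicComplete_span_iff] at hM ⊢
  obtain ⟨h1, h2⟩ := hM
  let b := Module.Free.chooseBasis R R'
  obtain ⟨e⟩ : Nonempty (R' ⊗[R] M ≃+ (Module.Free.ChooseBasisIndex R R' → M)) :=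
    ⟨((TensorProduct.comm R R' M).trans ((LinearEquiv.lTensor M b.equivFun).trans
      (TensorProduct.piScalarRight R R M _))).toAddEquiv⟩
  constructor
  · intro x hx
    apply e.injective
    rw [map_zero]
    funext i
    apply h1
    intro n
    obtain ⟨y, rfl⟩ := hx n
    exact ⟨e y i, by rw [map_nsmul]; rfl⟩
  · intro f hf
    have : ∀ i, ∃ L : M, ∀ n, ∃ y : M, e (f n) i - L = p ^ n • y := by
      intro i
      refine h2 (fun n => e (f n) i) ?_
      intro m n hmn
      obtain ⟨y, hy⟩ := hf m n hmn
      refine ⟨e y i, ?_⟩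
      rw [← Pi.sub_apply, ← map_sub, hy, map_nsmul]; rfl
    choose L hL using this
    choose y hy using hL
    refine ⟨e.symm L, fun n => ⟨e.symm fun i => y i n, ?_⟩⟩
    apply e.injective
    rw [map_sub, map_nsmul, e.apply_symm_apply, e.apply_symm_apply]
    funext i
    exact hy i n

variable (p : ℕ) [Fact p.Prime] (R R' : Type*) [CommRing R] [CommRing R'] [Algebra R R']
  [FrobeniusBase p R] [FrobeniusBase p R'] (A : Type*) [CommRing A] [Algebra R A]

theorem isAdicComplete_jetRing (n : ℕ) :
    IsAdicComplete (Ideal.span {(p : JetRing p R A n)}) (JetRing p R A n) := by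
  rw [isAdicComplete_span_iff]
  have h : IsAdicComplete (Ideal.span {(p : JetAlg p R A n)})
      (AdicCompletion (Ideal.span {(p : JetAlg p R A n)}) (JetAlg p R A n)) :=
    AdicCompletion.isAdicComplete ⟨{(p : JetAlg p R A n)}, by simp⟩
  rw [isAdicComplete_span_iff] at h
  exact h

instance [FrobeniusExt p R R'] (n : ℕ) : IsAdicComplete
    (Ideal.span {(p : R' ⊗[R] JetRing p R A n)}) (R' ⊗[R] JetRing p R A n) :=
  haveI := FrobeniusExt.free (p := p) (R := R) (R' := R')
  haveI := FrobeniusExt.finite (p := p) (R := R) (R' := R')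
  isAdicComplete_tensor p R R' _ (isAdicComplete_jetRing p R A n)

/-- The canonical homomorphism `O(Jⁿ_π(Spec (R' ⊗ A))) → R' ⊗ O(Jⁿ_p(Spec A))`. -/
def compare [FrobeniusExt p R R'] (n : ℕ) :
    JetRing p R' (R' ⊗[R] A) n →+* R' ⊗[R] JetRing p R A n :=
  completionLift p ((Algebra.TensorProduct.map (AlgHom.id R' R') (JetRing.of p R A n)).comp
    (compareAlg p R R' A n) : JetAlg p R' (R' ⊗[R] A) n →+* R' ⊗[R] JetRing p R A n)

end Complete

/-! ### Jet spaces of a smooth scheme -/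

section Global

variable {p : ℕ} [Fact p.Prime] {X : Scheme.{0}} (f : X ⟶ Spec (CommRingCat.of (Rp p)))

/-- The ring `O(U)` of an affine open subset `U` of an `R_p`-scheme, as an `R_p`-algebra. -/
def Sec (_f : X ⟶ Spec (CommRingCat.of (Rp p))) (U : X.affineOpens) : Type := Γ(X, U.1)

instance (U : X.affineOpens) : CommRing (Sec f U) := inferInstanceAs (CommRing Γ(X, U.1))

instance (U : X.affineOpens) : Algebra (Rp p) (Sec f U) :=
  ((f.appLE ⊤ U.1 le_top).hom.comp
    (Scheme.ΓSpecIso (CommRingCat.of (Rp p))).inv.hom : Rp p →+* Γ(X, U.1)).toAlgebra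

/-- The restriction `O(V) → O(U)` for affine open sets `U ⊆ V`. -/
def Sec.res {U V : X.affineOpens} (h : U ≤ V) : Sec f V →ₐ[Rp p] Sec f U where
  toRingHom := (X.presheaf.map (CategoryTheory.homOfLE h).op).hom
  commutes' r := by
    have := Scheme.Hom.appLE_map f (U := ⊤) (V := V.1) (V' := U.1) le_top
      (CategoryTheory.homOfLE h).op
    exact congrArg (fun q => q.hom ((Scheme.ΓSpecIso (CommRingCat.of (Rp p))).inv.hom r)) this

/-- The ring `O(Jⁿ_p(U))`, for `U` affine open in `X`. -/
abbrev PJet (n : ℕ) (U : X.affineOpens) : Type := JetRing p (Rp p) (Sec f U) n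

/-- The ring `O(Jⁿ_π(U_{R_π}))`, for `U` affine open in `X`. -/
abbrev PiJet (E : EisensteinPoly p) (n : ℕ) (U : X.affineOpens) : Type :=
  JetRing p (Rpi E) (Rpi E ⊗[Rp p] Sec f U) n

/-- The restriction `O(Jⁿ_p(V)) → O(Jⁿ_p(U))`. -/
def PJet.res (n : ℕ) {U V : X.affineOpens} (h : U ≤ V) : PJet f n V →+* PJet f n U :=
  JetRing.map p (Sec.res f h) n

/-- The restriction `O(Jⁿ_π(V_{R_π})) → O(Jⁿ_π(U_{R_π}))`. -/
def PiJet.res (E : EisensteinPoly p) (n : ℕ) {U V : X.affineOpens} (h : U ≤ V) :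
    PiJet f E n V →+* PiJet f E n U :=
  JetRing.map p
    (Algebra.TensorProduct.map (AlgHom.id (Rpi E) (Rpi E)) (Sec.res f h) :
      Rpi E ⊗[Rp p] Sec f V →ₐ[Rpi E] Rpi E ⊗[Rp p] Sec f U) n

/-- The ring `O(Jⁿ_p(X))` of global functions on the `p`-jet space of `X`. The jet space is glued
from the jet spaces of the affine open subsets of `X`. -/
def PFun (n : ℕ) : Subring (∀ U : X.affineOpens, PJet f n U) where
  carrier := {s | ∀ (U V : X.affineOpens) (h : U ≤ V), PJet.res f n h (s V) = s U}
  mul_mem' hs ht U V h := by simp only [Pi.mul_apply, map_mul, hs U V h, ht U V h]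
  one_mem' U V h := by simp only [Pi.one_apply, map_one]
  add_mem' hs ht U V h := by simp only [Pi.add_apply, map_add, hs U V h, ht U V h]
  zero_mem' U V h := by simp only [Pi.zero_apply, map_zero]
  neg_mem' hs U V h := by simp only [Pi.neg_apply, map_neg, hs U V h]

/-- The ring `O(Jⁿ_π(X_{R_π}))` of global functions on the `π`-jet space of `X_{R_π}`. The jet
space is glued from the jet spaces of the open sets `U_{R_π}`, for `U` affine open in `X`. -/
def PiFun (E : EisensteinPoly p) (n : ℕ) : Subring (∀ U : X.affineOpens, PiJet f E n U) where
  carrier := {s | ∀ (U V : X.affineOpens) (h : U ≤ V), PiJet.res f E n h (s V) = s U}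
  mul_mem' hs ht U V h := by simp only [Pi.mul_apply, map_mul, hs U V h, ht U V h]
  one_mem' U V h := by simp only [Pi.one_apply, map_one]
  add_mem' hs ht U V h := by simp only [Pi.add_apply, map_add, hs U V h, ht U V h]
  zero_mem' U V h := by simp only [Pi.zero_apply, map_zero]
  neg_mem' hs U V h := by simp only [Pi.neg_apply, map_neg, hs U V h]

/-- The canonical homomorphism `O(Jⁿ_π(U_{R_π})) → R_π ⊗ O(Jⁿ_p(U))`. -/
def toPJet (E : EisensteinPoly p) (n : ℕ) (U : X.affineOpens) :
    PiJet f E n U →+* Rpi E ⊗[Rp p] PJet f n U :=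
  compare p (Rp p) (Rpi E) (Sec f U) n

/-- The map `Tr ⊗ 1 : R_π ⊗ O(Jⁿ_p(U)) → O(Jⁿ_p(U))`. -/
def traceMap (E : EisensteinPoly p) (n : ℕ) (U : X.affineOpens) :
    Rpi E ⊗[Rp p] PJet f n U →ₗ[Rp p] PJet f n U :=
  (TensorProduct.lid (Rp p) (PJet f n U)).toLinearMap ∘ₗ
    (Algebra.trace (Rp p) (Rpi E)).rTensor (PJet f n U)

/-- `δ_π`-overconvergence: some `p ^ ν` times `s` is in the image of
`O(Jⁿ_π(X_{R_π})) → R_π ⊗ O(Jⁿ_p(X))`. -/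
def IsOverconvergent (E : EisensteinPoly p) (n : ℕ) (s : PFun f n) : Prop :=
  ∃ ν : ℕ, ∃ g : PiFun f E n, ∀ U, toPJet f E n U (g.1 U) = 1 ⊗ₜ ((p : PJet f n U) ^ ν * s.1 U)

/-- The form of `δ_π`-overconvergence that uses the trace: some `p ^ ν` times `s` is in the image
of the arithmetic trace `O(Jⁿ_π(X_{R_π})) → R_π ⊗ O(Jⁿ_p(X)) → O(Jⁿ_p(X))`. -/
def IsTraceOverconvergent (E : EisensteinPoly p) (n : ℕ) (s : PFun f n) : Prop :=
  ∃ ν : ℕ, ∃ g : PiFun f E n, ∀ U,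
    traceMap f E n U (toPJet f E n U (g.1 U)) = (p : PJet f n U) ^ ν * s.1 U

/-- An `R_p`-derivation of the structure sheaf of `X`. -/
structure SheafDer where
  der : ∀ U : X.affineOpens, Derivation (Rp p) (Sec f U) (Sec f U)
  res_der : ∀ (U V : X.affineOpens) (h : U ≤ V) (a : Sec f V),
    Sec.res f h (der V a) = der U (Sec.res f h a)

/-- An `R_p`-derivation of the sheaf of functions `U ↦ O(Jʳ_p(U))`. -/
structure JetDer (r : ℕ) where
  der : ∀ U : X.affineOpens, Derivation (Rp p) (PJet f r U) (PJet f r U)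
  res_der : ∀ (U V : X.affineOpens) (h : U ≤ V) (a : PJet f r V),
    PJet.res f r h (der V a) = der U (PJet.res f r h a)

variable {f}

/-- The action of a derivation on `O(Jʳ_p(X))`. -/
def JetDer.app {r : ℕ} (D : JetDer f r) (s : PFun f r) : PFun f r :=
  ⟨fun U => D.der U (s.1 U), fun U V h => by rw [D.res_der, s.2 U V h]⟩

/-- The extension of a derivation to an `R_π`-linear map of `R_π ⊗ O(Jʳ_p(U))`. -/
def JetDer.ext {r : ℕ} (D : JetDer f r) (E : EisensteinPoly p) (U : X.affineOpens) :
    Rpi E ⊗[Rp p] PJet f r U →ₗ[Rpi E] Rpi E ⊗[Rp p] PJet f r U :=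
  (D.der U : PJet f r U →ₗ[Rp p] PJet f r U).baseChange (Rpi E)

/-- The defining properties of the conjugate operators `∂_0, …, ∂_r` of `∂`: on functions of `X`,
`∂_j ∘ φˢ = 0` for `s ≠ j` and `∂_j ∘ φʲ = p ^ j • φʲ ∘ ∂`. -/
def IsConjugate (d : SheafDer f) {r : ℕ} (D : Fin (r + 1) → JetDer f r) : Prop :=
  ∀ (U : X.affineOpens) (j : Fin (r + 1)) (a : Sec f U),
    (∀ s : Fin (r + 1), s ≠ j → (D j).der U (JetRing.phiPow p (Rp p) r s a) = 0) ∧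
    (D j).der U (JetRing.phiPow p (Rp p) r j a) =
      (p : PJet f r U) ^ (j : ℕ) * JetRing.phiPow p (Rp p) r j (d.der U a)

end Global

end ArithJet

end

/-!
The conjugate operators exist already on polynomial jet rings over any base with a uniformizer
`ϖ` and a Frobenius lift: requiring `∂_j ∘ φ = ϖ φ ∘ ∂_{j-1}` and expanding `φ z = z ^ p + ϖ δ z`
forces `∂_j (δ z) = φ (∂_{j-1} z) - (p / ϖ) z ^ (p - 1) ∂_j z`, which can be taken as a recursive
definition on the variables. These derivations preserve the jet ideals, so they descend to jet
spaces and their completions, both for `(R_p, p)` and for `(R_π, π)`, and `ι` intertwines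
`(p / π) ^ j` times the operator on `π`-jets with the operator on `p`-jets. Hence `∂_j` preserves
the image of `ι` in every order `r`, and it commutes with `p ^ ν` and with the trace.

For uniqueness, the functions `φ^s a` with `s ≤ r` generate the jet ring after inverting `p`, so it
suffices that jet rings of a smooth algebra are `p`-torsion free. The universal property makes
jet rings formally smooth, because sections over square-zero extensions can be prolonged; thus
they are flat over `R_p`.
-/

noncomputable section

namespace ArithJet

section Derivations

open MvPolynomial

theorem derivation_mem_span {R A : Type*} [CommRing R] [CommRing A] [Algebra R A]
    (D : Derivation R A A) {s : Set A} (h : ∀ x ∈ s, D x ∈ Ideal.span s) {x : A}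
    (hx : x ∈ Ideal.span s) : D x ∈ Ideal.span s := by
  induction hx using Submodule.span_induction with
  | mem x hx => exact h x hx
  | zero => rw [map_zero]; exact Ideal.zero_mem _
  | add x y _ _ hx hy => rw [map_add]; exact Ideal.add_mem _ hx hy
  | smul a x hx hDx =>
    rw [smul_eq_mul, Derivation.leibniz]
    exact Ideal.add_mem _ (Ideal.mul_mem_left _ _ hDx) (Ideal.mul_mem_right _ _ hx)

variable {S S' σ P : Type*} [CommRing S] [CommRing S'] [CommRing P] [Algebra S' P]
  {f : MvPolynomial σ S →+* P} {D : Derivation S (MvPolynomial σ S) (MvPolynomial σ S)}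
  {D' : Derivation S' P P} {c : P}

theorem mul_map_derivation_sub_mem_of_X {I : Ideal P} (hC : ∀ a, D' (f (C a)) = 0)
    (hX : ∀ v, c * f (D (X v)) - D' (f (X v)) ∈ I) (x : MvPolynomial σ S) :
    c * f (D x) - D' (f x) ∈ I := by
  induction x using MvPolynomial.induction_on with
  | C a => simp [hC, ← algebraMap_eq]
  | add x y hx hy =>
    convert I.add_mem hx hy using 1
    simp only [map_add]; ring
  | mul_X x v hx =>
    convert I.add_mem (I.mul_mem_left (f x) (hX v)) (I.mul_mem_left (f (X v)) hx) using 1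
    simp only [map_mul, Derivation.leibniz, smul_eq_mul, map_add]; ring

theorem mul_map_derivation_eq_of_X (hC : ∀ a, D' (f (C a)) = 0)
    (hX : ∀ v, c * f (D (X v)) = D' (f (X v))) (x : MvPolynomial σ S) :
    c * f (D x) = D' (f x) :=
  sub_eq_zero.1 (mul_map_derivation_sub_mem_of_X (I := ⊥) hC (fun v => sub_eq_zero.2 (hX v)) x)

theorem map_derivation_eq_of_X (hC : ∀ a, D' (f (C a)) = 0) (hX : ∀ v, f (D (X v)) = D' (f (X v)))
    (x : MvPolynomial σ S) : f (D x) = D' (f x) := by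
  simpa only [one_mul] using
    mul_map_derivation_eq_of_X (c := 1) hC (fun v => (one_mul _).trans (hX v)) x

end Derivations

namespace JetPoly

open MvPolynomial

/-! ### Conjugate derivations of polynomial jet rings -/

section Basic

variable {p : ℕ} {S : Type*} [CommRing S] [FrobeniusBase p S] {ι : Type*}

theorem incl_C (n : ℕ) (a : S) : incl S ι n (C a) = C a := algHom_C _ a

theorem incl_X (n : ℕ) (v : Fin (n + 1) × ι) :
    incl S ι n (X v) = X (v.1.castSucc, v.2) := rename_X _ v

theorem frob_C (t : S) (n : ℕ) (a : S) : frob p ι t n (C a) = C (FrobeniusBase.phi p a) :=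
  eval₂Hom_C _ _ a

theorem frob_X (t : S) (n : ℕ) (v : Fin (n + 1) × ι) :
    frob p ι t n (X v) = X (v.1.castSucc, v.2) ^ p + C t * X (v.1.succ, v.2) :=
  eval₂Hom_X' _ _ v

theorem frob_incl (t : S) (n : ℕ) (x : JetPoly S ι n) :
    frob p ι t (n + 1) (incl S ι n x) = incl S ι (n + 1) (frob p ι t n x) := by
  have h : (frob p ι t (n + 1)).comp (incl S ι n) =
      (incl S ι (n + 1) : _ →+* _).comp (frob p ι t n) := by
    ext v : 2
    · simp [frob_C]
    · simp [frob_X, incl_X]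
  exact DFunLike.congr_fun h x

end Basic

section Delta

variable {p : ℕ} [Fact p.Prime] {S : Type*} [CommRing S] [FrobeniusBase p S] {ι : Type*} {t : S}
  (ht : FrobeniusBase.unif p ∣ t) (n : ℕ)

theorem frob_eq_pow_add_delta (x : JetPoly S ι n) :
    frob p ι t n x = incl S ι n x ^ p + C (FrobeniusBase.unif p : S) * delta ht n x := by
  rw [unif_mul_delta, add_sub_cancel]

theorem delta_X (k : Fin (n + 1)) (a : ι) :
    delta (dvd_refl (FrobeniusBase.unif p : S)) n (X (k, a)) = X (k.succ, a) := by
  apply unif_cancel (p := p)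
  rw [unif_mul_delta, frob_X, incl_X, add_sub_cancel_left]

theorem exists_delta_add (x y : JetPoly S ι n) :
    ∃ r, delta ht n (x + y) = delta ht n x + delta ht n y - incl S ι n x * incl S ι n y * r := by
  obtain ⟨r, hr⟩ := exists_add_pow_prime_eq (Fact.out : p.Prime) (incl S ι n x) (incl S ι n y)
  obtain ⟨c, hc⟩ := FrobeniusBase.unif_dvd (p := p) (R := S)
  have hpc : ((p : ℕ) : JetPoly S ι (n + 1)) = C (FrobeniusBase.unif p : S) * C c := by
    rw [← C_mul, ← hc, map_natCast]
  refine ⟨C c * r, unif_cancel (p := p) ?_⟩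
  rw [mul_sub, mul_add, unif_mul_delta, unif_mul_delta, unif_mul_delta, map_add, map_add, hr, hpc]
  ring

theorem delta_mul (x y : JetPoly S ι n) : delta ht n (x * y) =
    frob p ι t n x * delta ht n y + delta ht n x * incl S ι n y ^ p := by
  apply unif_cancel (p := p)
  linear_combination unif_mul_delta ht n (x * y) - frob p ι t n x * unif_mul_delta ht n y -
    incl S ι n y ^ p * unif_mul_delta ht n x + map_mul (frob p ι t n) x y -
    congrArg (· ^ p) (map_mul (incl S ι n) x y)

end Delta

section ConjDer

variable (p : ℕ) {S : Type*} [CommRing S] [FrobeniusBase p S] {ι : Type*} (t e : S) (d : ι → ι)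

/-- The prolongation of a derivation `D` from `S[x, …, δⁿ x]` to `S[x, …, δⁿ⁺¹ x]` with
`δⁿ⁺¹ x_a ↦ F (δⁿ x_a) - e (δⁿ x_a) ^ (p - 1) D (δⁿ x_a)`: one step in the recursion that defines
the conjugate derivations, with `F = φ ∘ ∂_{j-1}`. -/
def conjDerSucc {n : ℕ} (F : JetPoly S ι n → JetPoly S ι (n + 1))
    (D : Derivation S (JetPoly S ι n) (JetPoly S ι n)) :
    Derivation S (JetPoly S ι (n + 1)) (JetPoly S ι (n + 1)) :=
  mkDerivation S fun v => Fin.lastCases (motive := fun _ => JetPoly S ι (n + 1))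
    (F (X (Fin.last n, v.2)) -
      C e * X ((Fin.last n).castSucc, v.2) ^ (p - 1) * incl S ι n (D (X (Fin.last n, v.2))))
    (fun k => incl S ι n (D (X (k, v.2)))) v.1

/-- The conjugate derivations `∂_j` of `S[x, δ x, …, δⁿ x]` attached to the derivation
`x_a ↦ x_{d a}` of `S[x]`, where `t e = p` and `δ z = (φ z - z ^ p) / t`. Letting `j` range over
`ℤ`, with `∂_j = 0` for `j < 0`, makes the recursion
`∂_j (δ z) = φ (∂_{j-1} z) - e z ^ (p - 1) ∂_j z` uniform in `j`. -/
def conjDer : ∀ n : ℕ, ℤ → Derivation S (JetPoly S ι n) (JetPoly S ι n)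
  | 0, j => if j = 0 then mkDerivation S fun v => X (0, d v.2) else 0
  | n + 1, j => conjDerSucc p e (fun z => frob p ι t n (conjDer n (j - 1) z)) (conjDer n j)

theorem conjDer_zero_zero_X (v : Fin 1 × ι) : conjDer p t e d 0 0 (X v) = X (0, d v.2) :=
  mkDerivation_X S _ v

variable {d} in
theorem conjDer_zero_of_ne {j : ℤ} (hj : j ≠ 0) : conjDer p t e d 0 j = 0 := if_neg hj

theorem conjDer_castSucc (n : ℕ) (j : ℤ) (k : Fin (n + 1)) (a : ι) :
    conjDer p t e d (n + 1) j (X (k.castSucc, a)) =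
      incl S ι n (conjDer p t e d n j (X (k, a))) := by
  simp [conjDer, conjDerSucc, mkDerivation_X]

theorem conjDer_last (n : ℕ) (j : ℤ) (a : ι) :
    conjDer p t e d (n + 1) j (X (Fin.last (n + 1), a)) =
      frob p ι t n (conjDer p t e d n (j - 1) (X (Fin.last n, a))) -
        C e * X ((Fin.last n).castSucc, a) ^ (p - 1) *
          incl S ι n (conjDer p t e d n j (X (Fin.last n, a))) := by
  simp [conjDer, conjDerSucc, mkDerivation_X]

theorem conjDer_C (n : ℕ) (j : ℤ) (a : S) : conjDer p t e d n j (C a) = 0 :=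
  (conjDer p t e d n j).map_algebraMap a

theorem conjDer_of_neg (n : ℕ) : ∀ {j : ℤ}, j < 0 → conjDer p t e d n j = 0 := by
  induction n with
  | zero => exact fun hj => conjDer_zero_of_ne p t e hj.ne
  | succ n ih =>
    refine fun {j} hj => derivation_ext fun ⟨k, a⟩ => ?_
    induction k using Fin.lastCases with
    | last => simp [conjDer_last, ih hj, ih (show j - 1 < 0 by omega)]
    | cast k => simp [conjDer_castSucc, ih hj]

theorem conjDer_incl (n : ℕ) (j : ℤ) (x : JetPoly S ι n) :
    conjDer p t e d (n + 1) j (incl S ι n x) = incl S ι n (conjDer p t e d n j x) := by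
  refine (map_derivation_eq_of_X (f := (incl S ι n).toRingHom) (fun a => ?_) (fun v => ?_) x).symm
  · exact (congrArg _ (incl_C n a)).trans (conjDer_C p t e d _ j a)
  · exact ((congrArg _ (incl_X n v)).trans (conjDer_castSucc p t e d n j v.1 v.2)).symm

variable {t e}

theorem conjDer_frob_X_last (hte : t * e = p) (n : ℕ) (j : ℤ) (a : ι) :
    conjDer p t e d (n + 1) j (frob p ι t n (X (Fin.last n, a))) =
      C t * frob p ι t n (conjDer p t e d n (j - 1) (X (Fin.last n, a))) := by
  have hC : C t * C e = ((p : ℕ) : JetPoly S ι (n + 1)) := by rw [← C_mul, hte, map_natCast]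
  rw [frob_X, map_add, Derivation.leibniz_pow, Derivation.leibniz, conjDer_C, Fin.succ_last,
    conjDer_last, conjDer_castSucc]
  simp only [smul_eq_mul, nsmul_eq_mul, mul_zero, add_zero]
  rw [← hC]
  ring

theorem conjDer_frob_X (hte : t * e = p) (n : ℕ) (j : ℤ) (v : Fin (n + 1) × ι) :
    conjDer p t e d (n + 1) j (frob p ι t n (X v)) =
      C t * frob p ι t n (conjDer p t e d n (j - 1) (X v)) := by
  obtain ⟨k, a⟩ := v
  induction n with
  | zero =>
    obtain rfl : k = Fin.last 0 := Fin.ext (by omega)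
    exact conjDer_frob_X_last p d hte 0 j a
  | succ n ih =>
    induction k using Fin.lastCases with
    | last => exact conjDer_frob_X_last p d hte _ j a
    | cast k =>
      rw [← incl_X n (k, a), frob_incl, conjDer_incl, ih k, conjDer_incl, frob_incl, map_mul,
        incl_C]

theorem conjDer_frob (hte : t * e = p) (n : ℕ) (j : ℤ) (x : JetPoly S ι n) :
    conjDer p t e d (n + 1) j (frob p ι t n x) =
      C t * frob p ι t n (conjDer p t e d n (j - 1) x) := by
  refine (mul_map_derivation_eq_of_X (fun a => ?_) (fun v => ?_) x).symm
  · rw [frob_C, conjDer_C]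
  · exact (conjDer_frob_X p d hte n j v).symm

variable {p}

theorem conjDer_delta [Fact p.Prime] (hte : t * e = p) (ht : FrobeniusBase.unif p ∣ t) {u : S}
    (hu : t = FrobeniusBase.unif p * u) (n : ℕ) (j : ℤ) (x : JetPoly S ι n) :
    conjDer p t e d (n + 1) j (delta ht n x) =
      C u * (frob p ι t n (conjDer p t e d n (j - 1) x) -
        C e * incl S ι n x ^ (p - 1) * incl S ι n (conjDer p t e d n j x)) := by
  apply unif_cancel (p := p)
  have h := congrArg (conjDer p t e d (n + 1) j) (unif_mul_delta ht n x)
  rw [Derivation.leibniz, conjDer_C, map_sub, conjDer_frob p d hte, Derivation.leibniz_pow,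
    conjDer_incl] at h
  simp only [smul_eq_mul, nsmul_eq_mul, mul_zero, add_zero] at h
  have hp : ((p : ℕ) : JetPoly S ι (n + 1)) = C t * C e := by rw [← C_mul, hte, map_natCast]
  rw [h, hp, hu, C_mul]
  ring

theorem map_conjDer {S' : Type*} [CommRing S'] [FrobeniusBase p S'] {ι' : Type*} {t' e' : S'}
    {d' : ι' → ι'} {φ : S →+* S'} {h : ι → ι'} (F : ∀ n, JetPoly S ι n →+* JetPoly S' ι' n)
    (hC : ∀ n a, F n (C a) = C (φ a)) (hX : ∀ n v, F n (X v) = X (v.1, h v.2))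
    (hfrob : ∀ n x, F (n + 1) (frob p ι t n x) = frob p ι' t' n (F n x))
    (he : φ e = e') (hd : ∀ a, h (d a) = d' (h a)) (n : ℕ) :
    ∀ (j : ℤ) (x : JetPoly S ι n),
      F n (conjDer p t e d n j x) = conjDer p t' e' d' n j (F n x) := by
  have hincl (n x) : F (n + 1) (incl S ι n x) = incl S' ι' n (F n x) := by
    have : (F (n + 1)).comp (incl S ι n) = (incl S' ι' n : _ →+* _).comp (F n) := by
      ext v : 2 <;> simp [hC, hX, incl_X]
    exact DFunLike.congr_fun this x
  have hconst (n j a) : conjDer p t' e' d' n j (F n (C a)) = 0 := by rw [hC, conjDer_C]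
  induction n with
  | zero =>
    refine fun j => map_derivation_eq_of_X (hconst 0 j) fun v => ?_
    obtain rfl | hj := eq_or_ne j 0
    · rw [conjDer_zero_zero_X, hX, hX, conjDer_zero_zero_X, hd]
    · simp [conjDer_zero_of_ne p _ _ hj]
  | succ n ih =>
    refine fun j => map_derivation_eq_of_X (hconst _ j) fun ⟨k, a⟩ => ?_
    simp only [hX]
    induction k using Fin.lastCases with
    | last =>
      simp only [conjDer_last, map_sub, map_mul, map_pow, hfrob, ih, hC, hX, he, hincl]
    | cast k => rw [conjDer_castSucc, conjDer_castSucc, hincl, ih, hX]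

end ConjDer

end JetPoly

open MvPolynomial JetPoly

section JetIdeal

variable {p : ℕ} {R : Type*} [CommRing R] [FrobeniusBase p R] {B : Type*}

theorem conjDer_phiPow {e : R} (hu : (FrobeniusBase.unif p : R) = p)
    (he : FrobeniusBase.unif p * e = p) (d : B → B) (b : B) {r : ℕ} :
    ∀ (j : ℤ) {s : ℕ}, s ≤ r →
      conjDer p (FrobeniusBase.unif p) e d r j (JetPoly.phiPow p R r s b) =
        if s = j then (p : JetPoly R B r) ^ s * JetPoly.phiPow p R r s (d b) else 0 := by
  induction r with
  | zero =>
    intro j s hs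
    obtain rfl : s = 0 := by omega
    obtain rfl | hj := eq_or_ne j 0
    · simp [JetPoly.phiPow, conjDer_zero_zero_X]
    · simp [conjDer_zero_of_ne p _ _ hj, hj.symm]
  | succ r ih =>
    rintro j (_ | s) hs
    · simp only [JetPoly.phiPow]
      rw [conjDer_incl, ih j (Nat.zero_le r)]
      split_ifs <;> simp
    · have hsj : (s : ℤ) = j - 1 ↔ ((s + 1 : ℕ) : ℤ) = j := by omega
      simp only [JetPoly.phiPow]
      rw [conjDer_frob p d he, ih (j - 1) (by omega)]
      simp only [hsj]
      split_ifs
      · rw [map_mul, map_pow, map_natCast, hu, map_natCast, pow_succ']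
        ring
      · rw [map_zero, mul_zero]

variable {B' : Type*} [CommRing B] [Algebra R B] [CommRing B'] [Algebra R B']

theorem aeval_conjDer_zero (t e : R) (d : Derivation R B B) (x : JetPoly R B 0) :
    (aeval (fun v => v.2) : JetPoly R B 0 →ₐ[R] B) (conjDer p t e d 0 0 x) =
      d (aeval (fun v => v.2) x) :=
  map_derivation_eq_of_X (f := (aeval (fun v => v.2) : JetPoly R B 0 →ₐ[R] B).toRingHom)
    (fun a => by simp) (fun v => by simp [conjDer_zero_zero_X]) x

theorem jetPolyMap_conjDer {d : B → B} {d' : B' → B'} (h : B →ₐ[R] B')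
    (hd : ∀ b, h (d b) = d' (h b)) (t e : R) (n : ℕ) (j : ℤ) (x : JetPoly R B n) :
    JetPoly.map h n (conjDer p t e d n j x) = conjDer p t e d' n j (JetPoly.map h n x) :=
  map_conjDer d (φ := RingHom.id R) (h := h) (fun n => (JetPoly.map h n : _ →+* _))
    (fun n a => algHom_C (JetPoly.map h n) a) (fun _ v => rename_X _ v)
    (fun _ x => JetPoly.map_frob h t _ x) rfl hd n j x

variable [Fact p.Prime]

theorem jetIdeal_frob (n : ℕ) {x : JetPoly R B n} (hx : x ∈ jetIdeal p R B n) :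
    frob p B (FrobeniusBase.unif p : R) n x ∈ jetIdeal p R B (n + 1) := by
  rw [frob_eq_pow_add_delta dvd_rfl]
  exact Ideal.add_mem _
    (Ideal.pow_mem_of_mem _ (jetIdeal_incl n hx) _ (Fact.out : p.Prime).pos)
    (Ideal.mul_mem_left _ _ (jetIdeal_delta n hx))

theorem conjDer_mem_jetIdeal {e : R} (he : FrobeniusBase.unif p * e = p) (d : Derivation R B B)
    (n : ℕ) : ∀ (j : ℤ), ∀ x ∈ jetIdeal p R B n,
      conjDer p (FrobeniusBase.unif p) e d n j x ∈ jetIdeal p R B n := by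
  induction n with
  | zero =>
    intro j x hx
    obtain rfl | hj := eq_or_ne j 0
    · rw [jetIdeal, RingHom.mem_ker] at hx ⊢
      rw [aeval_conjDer_zero, hx, map_zero]
    · rw [conjDer_zero_of_ne p _ _ hj]
      exact Ideal.zero_mem _
  | succ n ih =>
    refine fun j x hx => derivation_mem_span _ ?_ hx
    rintro _ (⟨y, hy, rfl⟩ | ⟨y, hy, rfl⟩)
    · rw [conjDer_incl]
      exact jetIdeal_incl n (ih j y hy)
    · rw [conjDer_delta d he dvd_rfl (mul_one _).symm]
      exact Ideal.mul_mem_left _ _ (Ideal.sub_mem _ (jetIdeal_frob n (ih (j - 1) y hy))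
        (Ideal.mul_mem_left _ _ (jetIdeal_incl n (ih j y hy))))

end JetIdeal

section BaseChange

variable {R : Type*} (R' : Type*) [CommRing R] [CommRing R'] [Algebra R R']
  {A : Type*} [CommRing A] [Algebra R A]

/-- The `R'`-linear extension of a derivation of `A` to `R' ⊗ A`. -/
def derBaseChange (d : Derivation R A A) : Derivation R' (R' ⊗[R] A) (R' ⊗[R] A) :=
  Derivation.mk' ((d : A →ₗ[R] A).baseChange R') (by
    intro x y
    induction x using TensorProduct.induction_on with
    | zero => simp
    | add x x' hx hx' => rw [add_mul, map_add, hx, hx', map_add, add_smul, smul_add]; abel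
    | tmul r a =>
      induction y using TensorProduct.induction_on with
      | zero => simp
      | add y y' hy hy' => rw [mul_add, map_add, hy, hy', map_add, add_smul, smul_add]; abel
      | tmul s b =>
        simp [Algebra.TensorProduct.tmul_mul_tmul, TensorProduct.tmul_add, mul_comm s r])

theorem derBaseChange_tmul (d : Derivation R A A) (r : R') (a : A) :
    derBaseChange R' d (r ⊗ₜ a) = r ⊗ₜ d a := rfl

end BaseChange

section Compare

variable {p : ℕ} (R R' : Type*) [CommRing R] [CommRing R'] [Algebra R R']
  (A : Type*) [CommRing A] [Algebra R A]

theorem mixedProj_zero_eq [Fact p.Prime] [FrobeniusBase p R] (x : JetPoly R' A 0) :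
    mixedProj p R R' A 0 x = Algebra.TensorProduct.map (AlgHom.id R' R')
      ((JetAlg.zeroEquiv p R A).symm : A →ₐ[R] JetAlg p R A 0)
      (aeval (fun v => (1 : R') ⊗ₜ[R] v.2) x) := by
  have h : mixedProj p R R' A 0 = (Algebra.TensorProduct.map (AlgHom.id R' R')
      ((JetAlg.zeroEquiv p R A).symm : A →ₐ[R] JetAlg p R A 0)).comp
      (aeval (fun v => (1 : R') ⊗ₜ[R] v.2)) := by
    ext v : 1
    obtain ⟨k, a⟩ := v
    obtain rfl : k = 0 := Fin.fin_one_eq_zero k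
    simp only [mixedProj, AlgHom.comp_apply, aeval_X, Algebra.TensorProduct.map_tmul,
      AlgHom.id_apply]
    congr 1
    refine ((JetAlg.zeroEquiv p R A).symm_apply_eq.2 ?_).symm
    exact (aeval_X (fun v : Fin 1 × A => v.2) (0, a)).symm
  exact DFunLike.congr_fun h x

variable [FrobeniusBase p R']

variable {R A} in
theorem aeval_conjDer_mixed (t e : R') (d : Derivation R A A) (x : JetPoly R' A 0) :
    aeval (fun v => (1 : R') ⊗ₜ[R] v.2) (conjDer p t e d 0 0 x) =
      derBaseChange R' d (aeval (fun v => (1 : R') ⊗ₜ[R] v.2) x) :=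
  map_derivation_eq_of_X
    (f := (aeval (fun v => (1 : R') ⊗ₜ[R] v.2) : JetPoly R' A 0 →ₐ[R'] R' ⊗[R] A).toRingHom)
    (fun a => by simp [-Algebra.TensorProduct.algebraMap_apply])
    (fun v => by simp [conjDer_zero_zero_X, derBaseChange_tmul]) x

variable [Fact p.Prime] [FrobeniusBase p R]

variable {R A} in
theorem ker_mixedProj_frob [FrobeniusExt p R R'] (n : ℕ) {x : JetPoly R' A n}
    (hx : x ∈ RingHom.ker (mixedProj p R R' A n)) :
    frob p A (p : R') n x ∈ RingHom.ker (mixedProj p R R' A (n + 1)) := by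
  rw [frob_eq_pow_add_delta FrobeniusBase.unif_dvd]
  exact Ideal.add_mem _
    (Ideal.pow_mem_of_mem _ (ker_mixedProj_incl R' n hx) _ (Fact.out : p.Prime).pos)
    (Ideal.mul_mem_left _ _ (ker_mixedProj_delta R' n hx))

theorem mixedProj_mixedLift (b : R' ⊗[R] A) : mixedProj p R R' A 0 (mixedLift p R R' A b) =
    Algebra.TensorProduct.map (AlgHom.id R' R')
      ((JetAlg.zeroEquiv p R A).symm : A →ₐ[R] JetAlg p R A 0) b :=
  Function.surjInv_eq (mixedProj_surjective p R R' A 0) _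

theorem aeval_mixedLift (b : R' ⊗[R] A) :
    aeval (fun v => (1 : R') ⊗ₜ[R] v.2) (mixedLift p R R' A b) = b := by
  have h := mixedProj_mixedLift (p := p) R R' A b
  rw [mixedProj_zero_eq] at h
  exact (Algebra.TensorProduct.congr AlgEquiv.refl
    (JetAlg.zeroEquiv p R A).symm : R' ⊗[R] A ≃ₐ[R'] R' ⊗[R] JetAlg p R A 0).injective h

theorem comparePoly_C (n : ℕ) (a : R') : comparePoly p R R' A n (C a) = C a :=
  algHom_C (comparePoly p R R' A n) a

theorem comparePoly_X_castSucc (n : ℕ) (k : Fin (n + 1)) (b : R' ⊗[R] A) :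
    comparePoly p R R' A (n + 1) (X (k.castSucc, b)) =
      incl R' A n (comparePoly p R R' A n (X (k, b))) := by
  rw [← comparePoly_incl, incl_X]

theorem comparePoly_X_last (n : ℕ) (b : R' ⊗[R] A) :
    comparePoly p R R' A (n + 1) (X (Fin.last (n + 1), b)) =
      delta (p := p) FrobeniusBase.unif_dvd n (comparePoly p R R' A n (X (Fin.last n, b))) := by
  simp only [comparePoly, aeval_X, Fin.val_last]
  rfl

variable (p) {A} {R'} (c : R') (d : Derivation R A A)

/-- The failure of the comparison map from `ϖ`-jets to `p`-jets to intertwine `c ^ j` times the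
`j`-th conjugate derivation of the former with that of the latter, where `ϖ c = p`. -/
def conjDerDefect (n : ℕ) (j : ℤ) (x : JetPoly R' (R' ⊗[R] A) n) : JetPoly R' A n :=
  C c ^ j.toNat * comparePoly p R R' A n
      (conjDer p (FrobeniusBase.unif p) c (derBaseChange R' d) n j x) -
    conjDer p (p : R') 1 d n j (comparePoly p R R' A n x)

theorem conjDerDefect_zero_X_mem (j : ℤ) (b : R' ⊗[R] A) :
    conjDerDefect p R c d 0 j (X (0, b)) ∈ RingHom.ker (mixedProj p R R' A 0) := by
  obtain rfl | hj := eq_or_ne j 0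
  · have hX (b) : comparePoly p R R' A 0 (X (0, b)) = mixedLift p R R' A b := aeval_X _ _
    rw [RingHom.mem_ker, conjDerDefect, conjDer_zero_zero_X, hX, hX, Int.toNat_zero, pow_zero,
      one_mul, map_sub, mixedProj_mixedLift, mixedProj_zero_eq, aeval_conjDer_mixed,
      aeval_mixedLift, sub_self]
  · simp [conjDerDefect, conjDer_zero_of_ne p _ _ hj]

theorem conjDerDefect_castSucc (n : ℕ) (j : ℤ) (k : Fin (n + 1)) (b : R' ⊗[R] A) :
    conjDerDefect p R c d (n + 1) j (X (k.castSucc, b)) =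
      incl R' A n (conjDerDefect p R c d n j (X (k, b))) := by
  rw [conjDerDefect, conjDerDefect, conjDer_castSucc, comparePoly_incl, comparePoly_X_castSucc,
    conjDer_incl, map_sub, map_mul, map_pow, incl_C]

variable {p c}

theorem conjDerDefect_last (hc : FrobeniusBase.unif p * c = p) (hφ : FrobeniusBase.phi p c = c)
    (n : ℕ) (j : ℤ) (b : R' ⊗[R] A) :
    conjDerDefect p R c d (n + 1) j (X (Fin.last (n + 1), b)) =
      C c * (frob p A (p : R') n (conjDerDefect p R c d n (j - 1) (X (Fin.last n, b))) -
        incl R' A n (comparePoly p R R' A n (X (Fin.last n, b))) ^ (p - 1) *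
          incl R' A n (conjDerDefect p R c d n j (X (Fin.last n, b)))) := by
  have hfrob (y : JetPoly R' (R' ⊗[R] A) n) (hy : j < 1 → y = 0) :
      C c ^ j.toNat * frob p A (p : R') n (comparePoly p R R' A n y) =
        C c * frob p A (p : R') n (C c ^ (j - 1).toNat * comparePoly p R R' A n y) := by
    obtain hj | hj := lt_or_ge j 1
    · simp [hy hj]
    · rw [map_mul, map_pow, frob_C, hφ, ← mul_assoc, ← pow_succ',
        show (j - 1).toNat + 1 = j.toNat by omega]
  have hneg : j < 1 → conjDer p (FrobeniusBase.unif p) c (derBaseChange R' d) n (j - 1)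
      (X (Fin.last n, b)) = 0 := fun hj => by rw [conjDer_of_neg _ _ _ _ _ (by omega)]; rfl
  rw [conjDerDefect, conjDerDefect, conjDerDefect, conjDer_last, comparePoly_X_last,
    conjDer_delta d (mul_one _) _ hc.symm, map_sub, comparePoly_frob, mul_sub, hfrob _ hneg]
  simp only [map_sub, map_mul, map_pow, incl_C, comparePoly_C, comparePoly_incl,
    comparePoly_X_castSucc, map_one]
  ring

theorem conjDerDefect_mem [FrobeniusExt p R R'] (hc : FrobeniusBase.unif p * c = p)
    (hφ : FrobeniusBase.phi p c = c) (n : ℕ) :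
    ∀ (j : ℤ) (x : JetPoly R' (R' ⊗[R] A) n),
      conjDerDefect p R c d n j x ∈ RingHom.ker (mixedProj p R R' A n) := by
  suffices hX : ∀ (j : ℤ) (v : Fin (n + 1) × (R' ⊗[R] A)),
      conjDerDefect p R c d n j (X v) ∈ RingHom.ker (mixedProj p R R' A n) from
    fun j => mul_map_derivation_sub_mem_of_X (f := (comparePoly p R R' A n).toRingHom)
      (fun a => (congrArg _ (comparePoly_C R R' A n a)).trans (conjDer_C _ _ _ _ _ _ a)) (hX j)
  induction n with
  | zero =>
    rintro j ⟨k, b⟩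
    obtain rfl : k = 0 := Fin.fin_one_eq_zero k
    exact conjDerDefect_zero_X_mem p R c d j b
  | succ n ih =>
    rintro j ⟨k, b⟩
    induction k using Fin.lastCases with
    | last =>
      rw [conjDerDefect_last R d hc hφ]
      exact Ideal.mul_mem_left _ _ (Ideal.sub_mem _ (ker_mixedProj_frob R' n (ih _ _))
        (Ideal.mul_mem_left _ _ (ker_mixedProj_incl R' n (ih _ _))))
    | cast k =>
      rw [conjDerDefect_castSucc]
      exact ker_mixedProj_incl R' n (ih _ _)

end Compare

section Completion

variable {R S : Type*} [CommRing R] [CommRing S] [Algebra R S] {I : Ideal S}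

theorem derivation_mem_pow {D : Derivation R S S} (hD : ∀ x ∈ I, D x ∈ I) (n : ℕ) :
    ∀ x ∈ I ^ n, D x ∈ I ^ n := by
  induction n with
  | zero => simp
  | succ n ih =>
    intro x hx
    rw [pow_succ] at hx ⊢
    induction hx using Submodule.mul_induction_on' with
    | mem_mul_mem a ha b hb =>
      rw [Derivation.leibniz, smul_eq_mul, smul_eq_mul, mul_comm b]
      exact Ideal.add_mem _ (Ideal.mul_mem_mul ha (hD b hb)) (Ideal.mul_mem_mul (ih a ha) hb)
    | add a _ b _ ha hb => rw [map_add]; exact Ideal.add_mem _ ha hb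

theorem mkₐ_derivation_eq_zero {D : Derivation R S S} (hD : ∀ x ∈ I, D x ∈ I) (n : ℕ) (x : S)
    (hx : Ideal.Quotient.mkₐ R (I ^ n • ⊤ : Ideal S) x = 0) :
    Ideal.Quotient.mkₐ R (I ^ n • ⊤ : Ideal S) (D x) = 0 := by
  simp only [Ideal.Quotient.mkₐ_eq_mk, Ideal.Quotient.eq_zero_iff_mem, smul_eq_mul,
    Ideal.mul_top] at hx ⊢
  exact derivation_mem_pow hD n x hx

/-- The derivation modulo `I ^ n` induced by a derivation that preserves `I`; the modulus is written
as in the definition of `AdicCompletion`. -/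
def derModPow (D : Derivation R S S) (hD : ∀ x ∈ I, D x ∈ I) (n : ℕ) :
    Derivation R (S ⧸ (I ^ n • ⊤ : Ideal S)) (S ⧸ (I ^ n • ⊤ : Ideal S)) :=
  Derivation.liftOfSurjective (f := Ideal.Quotient.mkₐ R (I ^ n • ⊤ : Ideal S))
    Ideal.Quotient.mk_surjective (mkₐ_derivation_eq_zero hD n)

theorem derModPow_mk (D : Derivation R S S) (hD : ∀ x ∈ I, D x ∈ I) (n : ℕ) (x : S) :
    derModPow D hD n (Submodule.Quotient.mk x) = Submodule.Quotient.mk (D x) :=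
  Derivation.liftOfSurjective_apply (f := Ideal.Quotient.mkₐ R (I ^ n • ⊤ : Ideal S))
    Ideal.Quotient.mk_surjective (mkₐ_derivation_eq_zero hD n) x

theorem transitionMap_derModPow (D : Derivation R S S) (hD : ∀ x ∈ I, D x ∈ I) {m n : ℕ}
    (hmn : m ≤ n) (x : S ⧸ (I ^ n • ⊤ : Ideal S)) :
    AdicCompletion.transitionMap I S hmn (derModPow D hD n x) =
      derModPow D hD m (AdicCompletion.transitionMap I S hmn x) := by
  obtain ⟨x, rfl⟩ := Submodule.Quotient.mk_surjective _ x
  have hmk (y : S) : AdicCompletion.transitionMap I S hmn (Submodule.Quotient.mk y) =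
      Submodule.Quotient.mk y := Submodule.mapQ_apply _ _ _ _
  rw [derModPow_mk, hmk, hmk, derModPow_mk]

/-- The extension to the `I`-adic completion of a derivation that preserves `I`. -/
def completionDer (D : Derivation R S S) (hD : ∀ x ∈ I, D x ∈ I) :
    Derivation R (AdicCompletion I S) (AdicCompletion I S) :=
  Derivation.mk'
    { toFun := fun x => ⟨fun n => derModPow D hD n (x.val n), fun hmn =>
        (transitionMap_derModPow D hD hmn (x.val _)).trans
          (congrArg (derModPow D hD _) (x.property hmn))⟩
      map_add' := fun _ _ => AdicCompletion.ext fun n => map_add (derModPow D hD n) _ _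
      map_smul' := fun r _ => AdicCompletion.ext fun n => (derModPow D hD n).map_smul r _ }
    fun x y => AdicCompletion.ext fun n => (derModPow D hD n).leibniz (x.val n) (y.val n)

theorem completionDer_algebraMap (D : Derivation R S S) (hD : ∀ x ∈ I, D x ∈ I) (x : S) :
    completionDer D hD (algebraMap S _ x) = algebraMap S _ (D x) :=
  AdicCompletion.ext fun n => derModPow_mk D hD n x

theorem derivation_mem_span_natCast (D : Derivation R S S) (p : ℕ) :
    ∀ x ∈ Ideal.span {(p : S)}, D x ∈ Ideal.span {(p : S)} :=
  fun _ => derivation_mem_span D (by simp)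

end Completion

section PadicCompletion

variable {p : ℕ} {S : Type*} [CommRing S]

theorem exists_eq_algebraMap_add_nsmul (x : AdicCompletion (Ideal.span {(p : S)}) S) (m : ℕ) :
    ∃ (s : S) (y : AdicCompletion (Ideal.span {(p : S)}) S),
      x = algebraMap S (AdicCompletion (Ideal.span {(p : S)}) S) s + p ^ m • y := by
  obtain ⟨s, hs⟩ := Submodule.mkQ_surjective _ (AdicCompletion.eval _ S m x)
  have hker : x - AdicCompletion.of (Ideal.span {(p : S)}) S s ∈
      (AdicCompletion.eval (Ideal.span {(p : S)}) S m).ker := by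
    rw [LinearMap.mem_ker, map_sub, AdicCompletion.eval_of, hs, sub_self]
  rw [← AdicCompletion.pow_smul_top_eq_ker_eval ⟨{(p : S)}, by simp⟩,
    Ideal.span_singleton_pow, Submodule.ideal_span_singleton_smul,
    Submodule.mem_smul_pointwise_iff_exists] at hker
  obtain ⟨y, -, hy⟩ := hker
  refine ⟨s, y, ?_⟩
  rw [← Nat.cast_pow, Nat.cast_smul_eq_nsmul] at hy
  rw [hy]
  exact (add_sub_cancel _ _).symm

theorem completion_addHom_ext (T : Type*) {M : Type*} [CommRing T] [AddCommGroup M] [Module T M]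
    [IsHausdorff (Ideal.span {(p : T)}) M]
    {F G : AdicCompletion (Ideal.span {(p : S)}) S →+ M}
    (h : ∀ s, F (algebraMap S _ s) = G (algebraMap S _ s))
    (x : AdicCompletion (Ideal.span {(p : S)}) S) : F x = G x := by
  rw [← sub_eq_zero]
  refine IsHausdorff.haus ‹IsHausdorff (Ideal.span {(p : T)}) M› _ fun n => ?_
  obtain ⟨s, y, rfl⟩ := exists_eq_algebraMap_add_nsmul x n
  rw [SModEq.zero, map_add, map_add, h, map_nsmul, map_nsmul, add_sub_add_left_eq_sub, ← nsmul_sub,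
    ← Nat.cast_smul_eq_nsmul T, Nat.cast_pow]
  exact Submodule.smul_mem_smul (Ideal.pow_mem_pow (Ideal.mem_span_singleton_self _) n) trivial

theorem dvd_of_natCast_mul_algebraMap_eq (hp : (p : S) ∈ S⁰) {n : ℕ} {s : S}
    {y : AdicCompletion (Ideal.span {(p : S)}) S}
    (h : algebraMap S (AdicCompletion (Ideal.span {(p : S)}) S) (p * s) = p ^ (n + 1) • y) :
    (p : S) ^ n ∣ s := by
  have hmod := congrArg (AdicCompletion.evalₐ (Ideal.span {(p : S)}) (n + 1)) h
  rw [AlgHom.commutes, map_nsmul, nsmul_eq_mul, Nat.cast_pow,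
    ← map_natCast (algebraMap S (S ⧸ Ideal.span {(p : S)} ^ (n + 1))), ← map_pow,
    Ideal.Quotient.algebraMap_eq, Ideal.Quotient.eq_zero_iff_mem.2
      (Ideal.pow_mem_pow (Ideal.mem_span_singleton_self _) _), zero_mul,
    Ideal.Quotient.eq_zero_iff_mem, Ideal.span_singleton_pow, Ideal.mem_span_singleton,
    pow_succ'] at hmod
  exact (dvd_cancel_left_mem_nonZeroDivisors hp).1 hmod

theorem natCast_mem_nonZeroDivisors_completion (hp : (p : S) ∈ S⁰) :
    (p : AdicCompletion (Ideal.span {(p : S)}) S) ∈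
      (AdicCompletion (Ideal.span {(p : S)}) S)⁰ := by
  refine mem_nonZeroDivisors_iff_right.2 fun x hx =>
    IsHausdorff.haus (I := Ideal.span {(p : S)}) inferInstance x fun n => ?_
  obtain ⟨s, y, rfl⟩ := exists_eq_algebraMap_add_nsmul x n
  obtain ⟨u, rfl⟩ : (p : S) ^ n ∣ s := by
    refine dvd_of_natCast_mul_algebraMap_eq hp (y := -y) ?_
    rw [map_mul, map_natCast, nsmul_eq_mul, Nat.cast_pow]
    rw [nsmul_eq_mul, Nat.cast_pow] at hx
    linear_combination hx
  rw [SModEq.zero, ← Nat.cast_smul_eq_nsmul S, Nat.cast_pow, map_mul, ← Algebra.smul_def,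
    ← smul_add]
  exact Submodule.smul_mem_smul (Ideal.pow_mem_pow (Ideal.mem_span_singleton_self _) n) trivial

theorem completionMap_algebraMap {T : Type*} [CommRing T] (f : S →+* T) (s : S) :
    completionMap p f (algebraMap S _ s) = algebraMap T _ (f s) := by
  refine AdicCompletion.ext_evalₐ fun n => ?_
  rw [completionMap, AdicCompletion.evalₐ_liftRingHom, AlgHom.commutes, RingHom.comp_apply,
    RingHom.coe_coe, AlgHom.commutes]
  · rfl
  · exact fun hle => RingHom.ext fun x => factorPow_modPow p f hle x

theorem completionLift_algebraMap {T : Type*} [CommRing T]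
    [IsAdicComplete (Ideal.span {(p : T)}) T] (f : S →+* T) (s : S) :
    completionLift p f (algebraMap S _ s) = f s := by
  refine IsHausdorff.eq_iff_smodEq (I := Ideal.span {(p : T)}) |>.2 fun n => ?_
  rw [SModEq.sub_mem, smul_eq_mul, Ideal.mul_top, ← Ideal.Quotient.eq_zero_iff_mem,
    map_sub, sub_eq_zero, completionLift, IsAdicComplete.mk_liftRingHom, RingHom.comp_apply,
    RingHom.coe_coe, AlgHom.commutes]
  · rfl
  · exact fun hle => RingHom.ext fun x => factorPow_modPow p f hle x

end PadicCompletion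

/-! ### Conjugate derivations of jet rings -/

section JetDerivations

variable {p : ℕ} [Fact p.Prime] {R : Type*} [CommRing R] [FrobeniusBase p R]
  {B B' : Type*} [CommRing B] [Algebra R B] [CommRing B'] [Algebra R B']

theorem JetAlg.mk_surjective (n : ℕ) : Function.Surjective (JetAlg.mk p R B n) :=
  Ideal.Quotient.mk_surjective

theorem JetAlg.mk_eq_zero {n : ℕ} {x : JetPoly R B n} :
    JetAlg.mk p R B n x = 0 ↔ x ∈ jetIdeal p R B n :=
  Ideal.Quotient.eq_zero_iff_mem

theorem JetAlg.map_mk (h : B →ₐ[R] B') (n : ℕ) (x : JetPoly R B n) :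
    JetAlg.map p h n (JetAlg.mk p R B n x) = JetAlg.mk p R B' n (JetPoly.map h n x) :=
  rfl

theorem JetRing.map_of (h : B →ₐ[R] B') (n : ℕ) (x : JetAlg p R B n) :
    JetRing.map p h n (JetRing.of p R B n x) = JetRing.of p R B' n (JetAlg.map p h n x) :=
  completionMap_algebraMap (JetAlg.map p h n : JetAlg p R B n →+* JetAlg p R B' n) x

theorem JetRing.addHom_ext (T : Type*) {M : Type*} [CommRing T] [AddCommGroup M] [Module T M]
    [IsHausdorff (Ideal.span {(p : T)}) M] {n : ℕ} {F G : JetRing p R B n →+ M}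
    (h : ∀ x, F (JetRing.of p R B n (JetAlg.mk p R B n x)) =
      G (JetRing.of p R B n (JetAlg.mk p R B n x))) (x : JetRing p R B n) : F x = G x := by
  refine completion_addHom_ext T (S := JetAlg p R B n) (fun s => ?_) x
  obtain ⟨x, rfl⟩ := JetAlg.mk_surjective n s
  exact h x

theorem JetAlg.mk_conjDer_eq_zero {e : R} (he : FrobeniusBase.unif p * e = p)
    (d : Derivation R B B) (n : ℕ) (j : ℤ) (x : JetPoly R B n) (hx : JetAlg.mk p R B n x = 0) :
    JetAlg.mk p R B n (conjDer p (FrobeniusBase.unif p) e d n j x) = 0 :=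
  mk_eq_zero.2 (conjDer_mem_jetIdeal he d n j x (mk_eq_zero.1 hx))

/-- The `j`-th conjugate derivation of the `n`-th term of the universal prolongation sequence. -/
def JetAlg.conjDer {e : R} (he : FrobeniusBase.unif p * e = p) (d : Derivation R B B) (n : ℕ)
    (j : ℤ) : Derivation R (JetAlg p R B n) (JetAlg p R B n) :=
  Derivation.liftOfSurjective (f := JetAlg.mk p R B n) (mk_surjective n)
    (mk_conjDer_eq_zero he d n j)

theorem JetAlg.conjDer_mk {e : R} (he : FrobeniusBase.unif p * e = p) (d : Derivation R B B)
    (n : ℕ) (j : ℤ) (x : JetPoly R B n) : JetAlg.conjDer he d n j (JetAlg.mk p R B n x) =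
      JetAlg.mk p R B n (JetPoly.conjDer p (FrobeniusBase.unif p) e d n j x) :=
  Derivation.liftOfSurjective_apply (f := JetAlg.mk p R B n) (mk_surjective n)
    (mk_conjDer_eq_zero he d n j) x

/-- The `j`-th conjugate derivation of the ring of functions of the `n`-th jet space. -/
def JetRing.conjDer {e : R} (he : FrobeniusBase.unif p * e = p) (d : Derivation R B B) (n : ℕ)
    (j : ℤ) : Derivation R (JetRing p R B n) (JetRing p R B n) :=
  completionDer (JetAlg.conjDer he d n j) (derivation_mem_span_natCast _ p)

theorem JetRing.conjDer_of {e : R} (he : FrobeniusBase.unif p * e = p) (d : Derivation R B B)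
    (n : ℕ) (j : ℤ) (x : JetAlg p R B n) : JetRing.conjDer he d n j (JetRing.of p R B n x) =
      JetRing.of p R B n (JetAlg.conjDer he d n j x) :=
  completionDer_algebraMap (JetAlg.conjDer he d n j) (derivation_mem_span_natCast _ p) x

theorem JetRing.map_conjDer {e : R} (he : FrobeniusBase.unif p * e = p) {d : Derivation R B B}
    {d' : Derivation R B' B'} (h : B →ₐ[R] B') (hd : ∀ b, h (d b) = d' (h b)) (n : ℕ) (j : ℤ)
    (x : JetRing p R B n) : JetRing.map p h n (JetRing.conjDer he d n j x) =
      JetRing.conjDer he d' n j (JetRing.map p h n x) := by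
  have := isAdicComplete_jetRing p R B' n
  refine JetRing.addHom_ext (JetRing p R B' n)
    (F := (JetRing.map p h n : JetRing p R B n →+ JetRing p R B' n).comp
      (JetRing.conjDer he d n j : JetRing p R B n →+ JetRing p R B n))
    (G := (JetRing.conjDer he d' n j : JetRing p R B' n →+ JetRing p R B' n).comp
      (JetRing.map p h n : JetRing p R B n →+ JetRing p R B' n)) (fun z => ?_) x
  simp only [AddMonoidHom.coe_comp, AddMonoidHom.coe_coe, Function.comp_apply]
  rw [conjDer_of, JetAlg.conjDer_mk, map_of, map_of, JetAlg.map_mk, JetAlg.map_mk, conjDer_of,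
    JetAlg.conjDer_mk, jetPolyMap_conjDer h hd]

theorem JetRing.conjDer_phiPow {e : R} (hu : (FrobeniusBase.unif p : R) = p)
    (he : FrobeniusBase.unif p * e = p) (d : Derivation R B B) {r s : ℕ} (hs : s ≤ r) (j : ℤ)
    (b : B) : JetRing.conjDer he d r j (JetRing.phiPow p R r s b) =
      if s = j then (p : JetRing p R B r) ^ s * JetRing.phiPow p R r s (d b) else 0 := by
  rw [phiPow, conjDer_of, JetAlg.conjDer_mk, ArithJet.conjDer_phiPow hu he d b j hs]
  split_ifs
  · rw [phiPow, map_mul, map_mul, map_pow, map_pow, map_natCast, map_natCast]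
  · rw [map_zero, map_zero]

end JetDerivations

section CompareDer

variable {p : ℕ} [Fact p.Prime] {R : Type*} (R' : Type*) [CommRing R] [CommRing R'] [Algebra R R']
  [FrobeniusBase p R] [FrobeniusBase p R'] {A : Type*} [CommRing A] [Algebra R A]

theorem map_algebraMap_conjDer [FrobeniusExt p R R'] (d : A → A) (n : ℕ) (j : ℤ)
    (x : JetPoly R A n) :
    MvPolynomial.map (algebraMap R R') (conjDer p (FrobeniusBase.unif p) 1 d n j x) =
      conjDer p (p : R') 1 d n j (MvPolynomial.map (algebraMap R R') x) :=
  map_conjDer d (h := id) (fun _ => MvPolynomial.map (algebraMap R R'))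
    (fun _ a => map_C _ a) (fun _ v => map_X _ v) (fun n x => (frob_mixed R' n x).symm)
    (map_one _) (fun _ => rfl) n j x

theorem mixedProj_map (n : ℕ) (x : JetPoly R A n) :
    mixedProj p R R' A n (MvPolynomial.map (algebraMap R R') x) = 1 ⊗ₜ JetAlg.mk p R A n x := by
  simpa using mixedProj_algebraTensor p R R' A n (1 ⊗ₜ x)

theorem mixedProj_conjDer [FrobeniusExt p R R'] (hu : FrobeniusBase.unif p * (1 : R) = p)
    (d : Derivation R A A) (n : ℕ) (j : ℤ) (x : JetPoly R' A n) :
    mixedProj p R R' A n (conjDer p (p : R') 1 d n j x) =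
      derBaseChange R' (JetAlg.conjDer hu d n j) (mixedProj p R R' A n x) := by
  refine map_derivation_eq_of_X (f := (mixedProj p R R' A n).toRingHom) (fun a => ?_)
    (fun v => ?_) x
  · exact (congrArg _ (algHom_C _ a)).trans (Derivation.map_algebraMap _ a)
  · change mixedProj p R R' A n (conjDer p (p : R') 1 d n j (X v)) =
      derBaseChange R' (JetAlg.conjDer hu d n j) (mixedProj p R R' A n (X v))
    rw [← MvPolynomial.map_X (algebraMap R R') v, ← map_algebraMap_conjDer, mixedProj_map,
      mixedProj_map, derBaseChange_tmul, JetAlg.conjDer_mk]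

theorem compareAlg_mk [FrobeniusExt p R R'] (n : ℕ) (x : JetPoly R' (R' ⊗[R] A) n) :
    compareAlg p R R' A n (JetAlg.mk p R' (R' ⊗[R] A) n x) =
      mixedProj p R R' A n (comparePoly p R R' A n x) :=
  rfl

theorem compareAlg_conjDer [FrobeniusExt p R R'] (hu : FrobeniusBase.unif p * (1 : R) = p)
    {c : R'} (hc : FrobeniusBase.unif p * c = p) (hφ : FrobeniusBase.phi p c = c)
    (d : Derivation R A A) (n : ℕ) (j : ℤ) (x : JetAlg p R' (R' ⊗[R] A) n) :
    compareAlg p R R' A n (c ^ j.toNat • JetAlg.conjDer hc (derBaseChange R' d) n j x) =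
      derBaseChange R' (JetAlg.conjDer hu d n j) (compareAlg p R R' A n x) := by
  obtain ⟨x, rfl⟩ := JetAlg.mk_surjective n x
  have h := conjDerDefect_mem R d hc hφ n j x
  rw [RingHom.mem_ker, conjDerDefect, map_sub, sub_eq_zero, mixedProj_conjDer R' hu, map_mul,
    map_pow, algHom_C, ← map_pow, ← Algebra.smul_def] at h
  rw [map_smul, JetAlg.conjDer_mk, compareAlg_mk, compareAlg_mk, ← h]

theorem compare_of [FrobeniusExt p R R'] (n : ℕ) (x : JetAlg p R' (R' ⊗[R] A) n) :
    compare p R R' A n (JetRing.of p R' (R' ⊗[R] A) n x) =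
      Algebra.TensorProduct.map (AlgHom.id R' R') (JetRing.of p R A n)
        (compareAlg p R R' A n x) :=
  completionLift_algebraMap _ x

theorem derBaseChange_map {S T : Type*} [CommRing S] [CommRing T] [Algebra R S] [Algebra R T]
    {D : Derivation R S S} {D' : Derivation R T T} (f : S →ₐ[R] T)
    (hf : ∀ s, D' (f s) = f (D s)) (y : R' ⊗[R] S) :
    derBaseChange R' D' (Algebra.TensorProduct.map (AlgHom.id R' R') f y) =
      Algebra.TensorProduct.map (AlgHom.id R' R') f (derBaseChange R' D y) := by
  induction y using TensorProduct.induction_on with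
  | zero => simp only [map_zero]
  | tmul r a => simp [derBaseChange_tmul, hf]
  | add y y' hy hy' => simp only [map_add, hy, hy']

/-- The factor `c ^ j = (p / ϖ) ^ j` appears because `∂_j ∘ φ^j` is `ϖ^j φ^j ∘ ∂` on `ϖ`-jets and
`p^j φ^j ∘ ∂` on `p`-jets. -/
theorem compare_conjDer [FrobeniusExt p R R'] (hu : FrobeniusBase.unif p * (1 : R) = p)
    {c : R'} (hc : FrobeniusBase.unif p * c = p) (hφ : FrobeniusBase.phi p c = c)
    (d : Derivation R A A) (n : ℕ) (j : ℤ) (x : JetRing p R' (R' ⊗[R] A) n) :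
    compare p R R' A n (c ^ j.toNat • JetRing.conjDer hc (derBaseChange R' d) n j x) =
      derBaseChange R' (JetRing.conjDer hu d n j) (compare p R R' A n x) := by
  refine JetRing.addHom_ext (R' ⊗[R] JetRing p R A n)
    (F := (compare p R R' A n : _ →+ R' ⊗[R] JetRing p R A n).comp
      ((c ^ j.toNat • JetRing.conjDer hc (derBaseChange R' d) n j :
        Derivation R' (JetRing p R' (R' ⊗[R] A) n) (JetRing p R' (R' ⊗[R] A) n)) :
          JetRing p R' (R' ⊗[R] A) n →+ JetRing p R' (R' ⊗[R] A) n))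
    (G := (derBaseChange R' (JetRing.conjDer hu d n j) : _ →+ R' ⊗[R] JetRing p R A n).comp
      (compare p R R' A n : _ →+ R' ⊗[R] JetRing p R A n)) (fun z => ?_) x
  change compare p R R' A n (c ^ j.toNat • JetRing.conjDer hc (derBaseChange R' d) n j
      (JetRing.of p R' (R' ⊗[R] A) n (JetAlg.mk p R' (R' ⊗[R] A) n z))) =
    derBaseChange R' (JetRing.conjDer hu d n j)
      (compare p R R' A n (JetRing.of p R' (R' ⊗[R] A) n (JetAlg.mk p R' (R' ⊗[R] A) n z)))
  rw [JetRing.conjDer_of, ← map_smul, compare_of, compare_of, compareAlg_conjDer R' hu hc hφ,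
    derBaseChange_map R' (JetRing.of p R A n) (JetRing.conjDer_of hu d n j)]

end CompareDer

/-! ### Jet algebras of smooth algebras -/

section Prolong

variable (p : ℕ) [Fact p.Prime] {S : Type*} [CommRing S] [FrobeniusBase p S] {ι κ : Type*}
  (σ : ι → JetPoly S κ 0)

/-- The element `δⁱ (σ a)` of `S[x, δ x, …, δⁿ x]`, for `i ≤ n`. -/
def prolongPow : ∀ n : ℕ, ℕ → ι → JetPoly S κ n
  | 0, _, a => σ a
  | n + 1, 0, a => incl S κ n (prolongPow n 0 a)
  | n + 1, i + 1, a => delta (dvd_refl (FrobeniusBase.unif p : S)) n (prolongPow n i a)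

/-- The homomorphism of polynomial jet rings with `δⁱ x_a ↦ δⁱ (σ a)`, the prolongation of the
substitution `x_a ↦ σ a`. -/
def prolong (n : ℕ) : JetPoly S ι n →ₐ[S] JetPoly S κ n :=
  aeval fun v => prolongPow p σ n v.1 v.2

theorem prolong_X (n : ℕ) (v : Fin (n + 1) × ι) :
    prolong p σ n (X v) = prolongPow p σ n v.1 v.2 :=
  aeval_X _ _

theorem prolong_C (n : ℕ) (a : S) : prolong p σ n (C a) = C a :=
  aeval_C _ _

theorem prolongPow_castSucc (n : ℕ) {i : ℕ} (hi : i ≤ n) (a : ι) :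
    prolongPow p σ (n + 1) i a = incl S κ n (prolongPow p σ n i a) := by
  induction n generalizing i with
  | zero =>
    obtain rfl : i = 0 := by omega
    rfl
  | succ n ih =>
    obtain _ | i := i
    · rfl
    · rw [prolongPow, ih (by omega), delta_incl, ← prolongPow]

theorem prolong_incl (n : ℕ) (x : JetPoly S ι n) :
    prolong p σ (n + 1) (incl S ι n x) = incl S κ n (prolong p σ n x) := by
  have h : (prolong p σ (n + 1)).comp (incl S ι n) = (incl S κ n).comp (prolong p σ n) := by
    ext v : 1
    simp only [AlgHom.comp_apply, incl_X, prolong_X]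
    exact prolongPow_castSucc p σ n v.1.is_le v.2
  exact DFunLike.congr_fun h x

theorem prolong_succ (n : ℕ) (k : Fin (n + 1)) (a : ι) : prolong p σ (n + 1) (X (k.succ, a)) =
    delta (dvd_refl (FrobeniusBase.unif p : S)) n (prolong p σ n (X (k, a))) := by
  rw [prolong_X, prolong_X]
  rfl

theorem prolong_frob (n : ℕ) (x : JetPoly S ι n) :
    prolong p σ (n + 1) (frob p ι (FrobeniusBase.unif p : S) n x) =
      frob p κ (FrobeniusBase.unif p : S) n (prolong p σ n x) := by
  have h : (prolong p σ (n + 1) : _ →+* _).comp (frob p ι (FrobeniusBase.unif p : S) n) =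
      (frob p κ (FrobeniusBase.unif p : S) n).comp (prolong p σ n) := by
    ext v : 1
    · ext a : 1
      simp [frob_C]
    · obtain ⟨k, a⟩ := v
      simp only [RingHom.comp_apply, RingHom.coe_coe, map_add, map_pow, map_mul, prolong_C,
        prolong_incl, prolong_succ, delta_X,
        frob_eq_pow_add_delta (dvd_refl (FrobeniusBase.unif p : S))]
  exact DFunLike.congr_fun h x

theorem prolong_delta (n : ℕ) (x : JetPoly S ι n) :
    prolong p σ (n + 1) (delta (dvd_refl (FrobeniusBase.unif p : S)) n x) =
      delta (dvd_refl (FrobeniusBase.unif p : S)) n (prolong p σ n x) := by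
  apply unif_cancel (p := p)
  rw [unif_mul_delta, ← prolong_frob, ← prolong_incl, ← map_pow, ← map_sub,
    ← unif_mul_delta (dvd_refl (FrobeniusBase.unif p : S)), map_mul, prolong_C]

theorem prolong_prolongPow {μ : Type*} (τ : μ → JetPoly S ι 0) (n i : ℕ) (a : μ) :
    prolong p σ n (prolongPow p τ n i a) =
      prolongPow p (fun b => prolong p σ 0 (τ b)) n i a := by
  induction n generalizing i with
  | zero => rfl
  | succ n ih =>
    cases i with
    | zero => rw [prolongPow, prolong_incl, ih, ← prolongPow]
    | succ i => rw [prolongPow, prolong_delta, ih, ← prolongPow]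

theorem prolong_prolong {μ : Type*} (τ : μ → JetPoly S ι 0) (n : ℕ) (x : JetPoly S μ n) :
    prolong p σ n (prolong p τ n x) = prolong p (fun b => prolong p σ 0 (τ b)) n x := by
  have h : (prolong p σ n).comp (prolong p τ n) =
      prolong p (fun b => prolong p σ 0 (τ b)) n := by
    ext v : 1
    rw [AlgHom.comp_apply, prolong_X, prolong_X, prolong_prolongPow]
  exact DFunLike.congr_fun h x

end Prolong

section SmoothJets

variable {p : ℕ} [Fact p.Prime] {R : Type*} [CommRing R] [FrobeniusBase p R]
  {A : Type*} [CommRing A] [Algebra R A]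

theorem delta_sub_delta_mem (n : ℕ) {x y : JetPoly R A n} (h : x - y ∈ jetIdeal p R A n) :
    delta (dvd_refl (FrobeniusBase.unif p : R)) n x -
      delta (dvd_refl (FrobeniusBase.unif p : R)) n y ∈ jetIdeal p R A (n + 1) := by
  obtain ⟨r, hr⟩ := exists_delta_add (dvd_refl (FrobeniusBase.unif p : R)) n (x - y) y
  rw [sub_add_cancel] at hr
  convert Ideal.sub_mem _ (jetIdeal_delta n h)
    (Ideal.mul_mem_right (incl R A n y * r) _ (jetIdeal_incl n h)) using 1
  linear_combination hr

theorem incl_mem_jetIdeal_sq (n : ℕ) {x : JetPoly R A n} (hx : x ∈ jetIdeal p R A n ^ 2) :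
    incl R A n x ∈ jetIdeal p R A (n + 1) ^ 2 := by
  have h : jetIdeal p R A n ≤ (jetIdeal p R A (n + 1)).comap (incl R A n) :=
    fun x hx => jetIdeal_incl n hx
  exact (Ideal.pow_right_mono h 2).trans (Ideal.le_comap_pow _ 2) hx

theorem delta_mem_jetIdeal_sq (n : ℕ) {x : JetPoly R A n} (hx : x ∈ jetIdeal p R A n ^ 2) :
    delta (dvd_refl (FrobeniusBase.unif p : R)) n x ∈ jetIdeal p R A (n + 1) ^ 2 := by
  rw [pow_two] at hx
  induction hx using Submodule.mul_induction_on' with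
  | mem_mul_mem u hu v hv =>
    rw [delta_mul, pow_two]
    exact Ideal.add_mem _ (Ideal.mul_mem_mul (jetIdeal_frob n hu) (jetIdeal_delta n hv))
      (Ideal.mul_mem_mul (jetIdeal_delta n hu)
        (Ideal.pow_mem_of_mem _ (jetIdeal_incl n hv) _ (Fact.out : p.Prime).pos))
  | add x hx' y _ hx hy =>
    exact delta_add_mem _ n _ hx (incl_mem_jetIdeal_sq n (by rwa [pow_two])) hy

theorem prolong_mem_jetIdeal_sq {σ : A → JetPoly R A 0}
    (h : ∀ x ∈ jetIdeal p R A 0, prolong p σ 0 x ∈ jetIdeal p R A 0 ^ 2) (n : ℕ) :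
    ∀ x ∈ jetIdeal p R A n, prolong p σ n x ∈ jetIdeal p R A n ^ 2 := by
  induction n with
  | zero => exact h
  | succ n ih =>
    suffices hle : jetIdeal p R A (n + 1) ≤
        (jetIdeal p R A (n + 1) ^ 2).comap (prolong p σ (n + 1)) from fun x hx => hle hx
    refine Ideal.span_le.2 ?_
    rintro _ (⟨y, hy, rfl⟩ | ⟨y, hy, rfl⟩)
    · rw [SetLike.mem_coe, Ideal.mem_comap, prolong_incl]
      exact incl_mem_jetIdeal_sq n (ih y hy)
    · rw [SetLike.mem_coe, Ideal.mem_comap, prolong_delta]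
      exact delta_mem_jetIdeal_sq n (ih y hy)

theorem X_sub_prolong_X_mem {σ : A → JetPoly R A 0} (h : ∀ a, X (0, a) - σ a ∈ jetIdeal p R A 0)
    (n : ℕ) (v : Fin (n + 1) × A) : X v - prolong p σ n (X v) ∈ jetIdeal p R A n := by
  induction n with
  | zero =>
    obtain ⟨k, a⟩ := v
    obtain rfl : k = 0 := Fin.eq_zero k
    rw [prolong_X]
    exact h a
  | succ n ih =>
    obtain ⟨k, a⟩ := v
    induction k using Fin.lastCases with
    | last =>
      rw [← Fin.succ_last, prolong_succ, ← delta_X (p := p)]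
      exact delta_sub_delta_mem n (ih (Fin.last n, a))
    | cast k =>
      rw [← incl_X n (k, a), prolong_incl, ← map_sub]
      exact jetIdeal_incl n (ih (k, a))

theorem mk_prolong {σ : A → JetPoly R A 0} (h : ∀ a, X (0, a) - σ a ∈ jetIdeal p R A 0) (n : ℕ)
    (x : JetPoly R A n) : JetAlg.mk p R A n (prolong p σ n x) = JetAlg.mk p R A n x := by
  have hmk : (JetAlg.mk p R A n).comp (prolong p σ n) = JetAlg.mk p R A n := by
    ext v : 1
    exact (Ideal.Quotient.eq.2 (X_sub_prolong_X_mem h n v)).symm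
  exact DFunLike.congr_fun hmk x

theorem exists_section_of_formallySmooth [Algebra.FormallySmooth R A] :
    ∃ σ : A → JetPoly R A 0, (∀ a, X (0, a) - σ a ∈ jetIdeal p R A 0) ∧
      ∀ x ∈ jetIdeal p R A 0, prolong p σ 0 x ∈ jetIdeal p R A 0 ^ 2 := by
  let ev : JetPoly R A 0 →ₐ[R] A := aeval fun v => v.2
  obtain ⟨g, hg⟩ := (Algebra.FormallySmooth.iff_split_surjection ev (aeval_surjective R A)).1
    inferInstance
  choose σ hσ using fun a => Ideal.Quotient.mk_surjective (g a)
  refine ⟨σ, fun a => ?_, fun x hx => ?_⟩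
  · have hev : ev (σ a) = a := by
      have := DFunLike.congr_fun hg a
      rwa [AlgHom.comp_apply, ← hσ] at this
    change ev (X (0, a) - σ a) = 0
    rw [map_sub, hev, aeval_X, sub_self]
  · have hprolong : (Ideal.Quotient.mkₐ R (RingHom.ker ev.toRingHom ^ 2)).comp (prolong p σ 0) =
        g.comp ev := by
      ext v : 1
      rw [AlgHom.comp_apply, AlgHom.comp_apply, prolong_X, aeval_X]
      exact hσ v.2
    have hx0 : ev x = 0 := hx
    refine Ideal.Quotient.eq_zero_iff_mem.1 ((DFunLike.congr_fun hprolong x).trans ?_)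
    rw [AlgHom.comp_apply, hx0]
    exact map_zero g

theorem formallySmooth_jetAlg [Algebra.FormallySmooth R A] (n : ℕ) :
    Algebra.FormallySmooth R (JetAlg p R A n) := by
  obtain ⟨σ, hσ, hσ2⟩ := exists_section_of_formallySmooth (p := p) (R := R) (A := A)
  have hker : RingHom.ker (JetAlg.mk p R A n).toRingHom = jetIdeal p R A n := Ideal.mk_ker
  refine Algebra.FormallySmooth.of_split (JetAlg.mk p R A n)
    (Ideal.Quotient.liftₐ (jetIdeal p R A n) ((Ideal.Quotient.mkₐ R
      (RingHom.ker (JetAlg.mk p R A n).toRingHom ^ 2)).comp (prolong p σ n)) fun x hx => ?_) ?_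
  · refine Ideal.Quotient.eq_zero_iff_mem.2 ?_
    rw [hker]
    exact prolong_mem_jetIdeal_sq hσ2 n x hx
  · refine AlgHom.ext fun z => ?_
    obtain ⟨x, rfl⟩ := JetAlg.mk_surjective n z
    exact mk_prolong hσ n x

theorem mk_prolong_surjective {κ : Type*} (f : MvPolynomial κ R →ₐ[R] A)
    (hf : Function.Surjective f) (n : ℕ) : Function.Surjective
      ((JetAlg.mk p R A n).comp (prolong p (fun i => X (0, f (X i))) n)) := by
  intro z
  obtain ⟨x, rfl⟩ := JetAlg.mk_surjective n z
  choose q hq using hf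
  refine ⟨prolong p (fun a => rename (fun i => (0, i)) (q a)) n x, ?_⟩
  let ev : JetPoly R A 0 →ₐ[R] A := aeval fun v => v.2
  have hev : (ev.comp (prolong p (fun i => X (0, f (X i))) 0)).comp
      (rename fun i => (0, i)) = f := by
    ext i
    simp only [AlgHom.comp_apply, rename_X, prolong_X]
    exact aeval_X _ _
  rw [AlgHom.comp_apply, prolong_prolong]
  refine mk_prolong (fun a => ?_) n x
  change ev _ = 0
  rw [map_sub, aeval_X, sub_eq_zero]
  exact ((DFunLike.congr_fun hev (q a)).trans (hq a)).symm

theorem flat_jetAlg [IsNoetherianRing R] [Algebra.Smooth R A] (n : ℕ) :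
    Module.Flat R (JetAlg p R A n) := by
  obtain ⟨m, f, hf⟩ := (Algebra.FiniteType.iff_quotient_mvPolynomial'' (R := R) (S := A)).1
    inferInstance
  have := formallySmooth_jetAlg (p := p) (R := R) (A := A) n
  exact Algebra.FormallySmooth.flat_of_algHom_of_isNoetherianRing _
    (mk_prolong_surjective (p := p) f hf n)

theorem natCast_mem_nonZeroDivisors_jetRing [IsNoetherianRing R] [Algebra.Smooth R A]
    (hp : (p : R) ∈ R⁰) (n : ℕ) : (p : JetRing p R A n) ∈ (JetRing p R A n)⁰ := by
  have := flat_jetAlg (p := p) (R := R) (A := A) n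
  refine natCast_mem_nonZeroDivisors_completion (p := p) (S := JetAlg p R A n) ?_
  rw [mem_nonZeroDivisors_iff_right]
  intro x hx
  refine Module.Flat.isSMulRegular_of_nonZeroDivisors (M := JetAlg p R A n) hp ?_
  simpa [Algebra.smul_def, mul_comm] using hx

end SmoothJets

/-! ### Uniqueness of the conjugate operators -/

section Uniqueness

variable {p : ℕ} {R B : Type*} [CommRing R]

theorem subring_eq_top_of_C_X {σ : Type*} {T : Subring (MvPolynomial σ R)} (hC : ∀ a, C a ∈ T)
    (hX : ∀ v, X v ∈ T) : T = ⊤ := by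
  refine eq_top_iff.2 fun z _ => ?_
  induction z using MvPolynomial.induction_on with
  | C a => exact hC a
  | add x y hx hy => exact add_mem (hx trivial) (hy trivial)
  | mul_X x v hx => exact mul_mem (hx trivial) (hX v)

theorem incl_phiPow [FrobeniusBase p R] (b : B) {r s : ℕ} (hs : s ≤ r) :
    incl R B r (JetPoly.phiPow p R r s b) = JetPoly.phiPow p R (r + 1) s b := by
  induction r generalizing s with
  | zero =>
    obtain rfl : s = 0 := by omega
    rfl
  | succ r ih =>
    obtain _ | s := s
    · rfl
    · rw [JetPoly.phiPow, ← frob_incl, ih (by omega), ← JetPoly.phiPow]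

theorem subring_eq_top_of_phiPow [FrobeniusBase p R] (hu : (FrobeniusBase.unif p : R) = p) {r : ℕ}
    {T : Subring (JetPoly R B r)} (hC : ∀ a, C a ∈ T)
    (hphi : ∀ s ≤ r, ∀ b, JetPoly.phiPow p R r s b ∈ T)
    (hdiv : ∀ z, (p : JetPoly R B r) * z ∈ T → z ∈ T) : T = ⊤ := by
  induction r with
  | zero =>
    refine subring_eq_top_of_C_X hC ?_
    rintro ⟨k, b⟩
    obtain rfl : k = 0 := Fin.eq_zero k
    exact hphi 0 le_rfl b
  | succ r ih =>
    have hincl : T.comap (incl R B r : JetPoly R B r →+* _) = ⊤ := by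
      refine ih (fun a => ?_) (fun s hs b => ?_) (fun z hz => hdiv _ ?_)
      · simpa [incl_C] using hC a
      · simpa [incl_phiPow b hs] using hphi s (by omega) b
      · simpa using hz
    have hfrob : T.comap (frob p B (FrobeniusBase.unif p : R) r) = ⊤ := by
      refine ih (fun a => ?_) (fun s hs b => hphi (s + 1) (by omega) b) (fun z hz => hdiv _ ?_)
      · simpa [frob_C] using hC _
      · simpa using hz
    refine subring_eq_top_of_C_X hC ?_
    rintro ⟨k, b⟩
    induction k using Fin.lastCases with
    | last =>
      have hi : incl R B r (X (Fin.last r, b)) ∈ T := hincl.ge trivial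
      have hf : frob p B (FrobeniusBase.unif p : R) r (X (Fin.last r, b)) ∈ T := hfrob.ge trivial
      have hsub := sub_mem hf (pow_mem hi p)
      rw [frob_X, incl_X, add_sub_cancel_left, hu, map_natCast, Fin.succ_last] at hsub
      exact hdiv _ hsub
    | cast k =>
      have hi : incl R B r (X (k, b)) ∈ T := hincl.ge trivial
      rwa [incl_X] at hi

/-- The ring of constants of a derivation. -/
def constantSubring {A : Type*} [CommRing A] [Algebra R A] (D : Derivation R A A) : Subring A where
  carrier := {x | D x = 0}
  mul_mem' {x y} (hx : D x = 0) (hy : D y = 0) := by simp [hx, hy]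
  one_mem' := D.map_one_eq_zero
  add_mem' {x y} (hx : D x = 0) (hy : D y = 0) := by simp [hx, hy]
  zero_mem' := map_zero D
  neg_mem' {x} (hx : D x = 0) := by simp [hx]

theorem mem_constantSubring {A : Type*} [CommRing A] [Algebra R A] {D : Derivation R A A} {x : A} :
    x ∈ constantSubring D ↔ D x = 0 :=
  Iff.rfl

variable [Fact p.Prime] [FrobeniusBase p R] [CommRing B] [Algebra R B]

theorem derivation_eq_zero_of_phiPow (hu : (FrobeniusBase.unif p : R) = p) {r : ℕ}
    (htf : (p : JetRing p R B r) ∈ (JetRing p R B r)⁰)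
    {D : Derivation R (JetRing p R B r) (JetRing p R B r)}
    (h : ∀ s ≤ r, ∀ b, D (JetRing.phiPow p R r s b) = 0) : D = 0 := by
  have := isAdicComplete_jetRing p R B r
  have htop : (constantSubring D).comap ((JetRing.of p R B r).comp (JetAlg.mk p R B r) :
      JetPoly R B r →+* JetRing p R B r) = ⊤ := by
    refine subring_eq_top_of_phiPow hu (fun a => ?_) h fun z hz => ?_
    · rw [Subring.mem_comap, mem_constantSubring]
      exact (congrArg D (algHom_C ((JetRing.of p R B r).comp (JetAlg.mk p R B r)) a)).trans
        (D.map_algebraMap a)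
    · rw [Subring.mem_comap, mem_constantSubring] at hz ⊢
      refine (mul_left_mem_nonZeroDivisors_eq_zero_iff htf).1 ?_
      simpa using hz
  exact Derivation.ext (JetRing.addHom_ext (JetRing p R B r)
    (F := (D : JetRing p R B r →+ JetRing p R B r)) (G := 0) fun z => htop.ge trivial)

end Uniqueness

theorem JetRing.map_algebraMap {p : ℕ} [Fact p.Prime] {R : Type*} [CommRing R] [FrobeniusBase p R]
    {B B' : Type*} [CommRing B] [Algebra R B] [CommRing B'] [Algebra R B'] (h : B →ₐ[R] B')
    (n : ℕ) (a : R) :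
    JetRing.map p h n (algebraMap R (JetRing p R B n) a) = algebraMap R (JetRing p R B' n) a := by
  rw [← (JetRing.of p R B n).commutes, JetRing.map_of, AlgHom.commutes, AlgHom.commutes]

/-! ### Conjugate operators on jet spaces of smooth schemes -/

section Global

variable {p : ℕ} [Fact p.Prime] {X : Scheme.{0}} {f : X ⟶ Spec (CommRingCat.of (Rp p))}

theorem unif_Rp : (FrobeniusBase.unif p : Rp p) = p := rfl

theorem unif_Rp_mul_one : (FrobeniusBase.unif p : Rp p) * 1 = p := mul_one _

theorem smooth_sec [Smooth f] (U : X.affineOpens) : Algebra.Smooth (Rp p) (Sec f U) :=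
  RingHom.Smooth.respectsIso.2 _
    (Scheme.ΓSpecIso (CommRingCat.of (Rp p))).symm.commRingCatIsoToRingEquiv
    (f.smooth_appLE (isAffineOpen_top _) U.2 le_top)

theorem natCast_mem_nonZeroDivisors_pJet [Smooth f] (r : ℕ) (U : X.affineOpens) :
    (p : PJet f r U) ∈ (PJet f r U)⁰ :=
  have := smooth_sec (f := f) U
  natCast_mem_nonZeroDivisors_jetRing
    (mem_nonZeroDivisors_of_ne_zero (WittVector.irreducible p).ne_zero) r

/-- The conjugate operators `∂_0, …, ∂_r` of a derivation `∂` of the structure sheaf. -/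
def SheafDer.conj (d : SheafDer f) (r : ℕ) (j : Fin (r + 1)) : JetDer f r where
  der U := JetRing.conjDer unif_Rp_mul_one (d.der U) r j
  res_der U V h := JetRing.map_conjDer unif_Rp_mul_one (Sec.res f h) (d.res_der U V h) r j

theorem SheafDer.isConjugate_conj (d : SheafDer f) (r : ℕ) : IsConjugate d (d.conj r) := by
  have hphi (U : X.affineOpens) (s j : Fin (r + 1)) (a : Sec f U) :=
    JetRing.conjDer_phiPow unif_Rp unif_Rp_mul_one (d.der U) s.is_le j a
  refine fun U j a => ⟨fun s hs => (hphi U s j a).trans (if_neg fun h => ?_),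
    (hphi U j j a).trans (if_pos rfl)⟩
  exact hs (Fin.ext (Int.ofNat_inj.1 h))

theorem JetDer.ext_der {r : ℕ} {D D' : JetDer f r} (h : ∀ U, D.der U = D'.der U) : D = D' := by
  cases D
  cases D'
  congr
  exact funext h

theorem IsConjugate.unique [Smooth f] {d : SheafDer f} {r : ℕ} {D D' : Fin (r + 1) → JetDer f r}
    (hD : IsConjugate d D) (hD' : IsConjugate d D') : D = D' := by
  funext j
  refine JetDer.ext_der fun U => sub_eq_zero.1 ?_
  refine derivation_eq_zero_of_phiPow unif_Rp (natCast_mem_nonZeroDivisors_pJet r U) ?_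
  intro s hs a
  rw [Derivation.sub_apply, sub_eq_zero]
  lift s to Fin (r + 1) using Nat.lt_succ_of_le hs
  obtain rfl | hsj := eq_or_ne s j
  · rw [(hD U s a).2, (hD' U s a).2]
  · rw [(hD U j a).1 s hsj, (hD' U j a).1 s hsj]

theorem exists_unif_mul_eq_natCast (E : EisensteinPoly p) :
    ∃ c : Rpi E, FrobeniusBase.unif p * c = p ∧ FrobeniusBase.phi p c = c := by
  obtain ⟨c, hc⟩ := Rpi.pi_dvd E
  have hphi := congrArg (Rpi.phi E) hc
  rw [map_natCast, map_mul, Rpi.phi_pi, hc] at hphi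
  exact ⟨c, hc.symm, ((mul_cancel_left_mem_nonZeroDivisors (Rpi.pi_mem E)).1 hphi).symm⟩

/-- The `R_π`-linear extension of `D` maps the image of
`O(Jʳ_π(X_{R_π})) → R_π ⊗ O(Jʳ_p(X))` into itself. -/
def JetDer.PreservesImage {r : ℕ} (D : JetDer f r) (E : EisensteinPoly p) : Prop :=
  ∀ g : PiFun f E r, ∃ h : PiFun f E r, ∀ U : X.affineOpens,
    D.ext E U (toPJet f E r U (g.1 U)) = toPJet f E r U (h.1 U)

theorem SheafDer.preservesImage_conj (d : SheafDer f) (E : EisensteinPoly p) {r : ℕ}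
    (j : Fin (r + 1)) : (d.conj r j).PreservesImage E := by
  intro g
  obtain ⟨c, hc, hphi⟩ := exists_unif_mul_eq_natCast E
  refine ⟨⟨fun U => c ^ (j : ℕ) •
    JetRing.conjDer hc (derBaseChange (Rpi E) (d.der U)) r j (g.1 U), fun U V h => ?_⟩, fun U =>
    (compare_conjDer (Rpi E) unif_Rp_mul_one hc hphi (d.der U) r j (g.1 U)).symm⟩
  have hres (a : Rpi E ⊗[Rp p] Sec f V) :=
    (derBaseChange_map (Rpi E) (Sec.res f h) (fun a => (d.res_der U V h a).symm) a).symm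
  beta_reduce
  rw [← g.2 U V h, Algebra.smul_def, Algebra.smul_def, map_mul]
  exact congrArg₂ (· * ·) (JetRing.map_algebraMap _ r _)
    (JetRing.map_conjDer hc _ hres r j (g.1 V))

theorem traceMap_ext {r : ℕ} (D : JetDer f r) (E : EisensteinPoly p) (U : X.affineOpens)
    (x : Rpi E ⊗[Rp p] PJet f r U) :
    traceMap f E r U (D.ext E U x) = D.der U (traceMap f E r U x) := by
  induction x using TensorProduct.induction_on with
  | zero => simp only [map_zero]
  | add x y hx hy => simp only [map_add, hx, hy]
  | tmul a x => exact ((D.der U).map_smul (Algebra.trace (Rp p) (Rpi E) a) x).symm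

theorem derivation_natCast_pow_mul {R A : Type*} [CommRing R] [CommRing A] [Algebra R A]
    (D : Derivation R A A) (m k : ℕ) (x : A) : D ((m : A) ^ k * x) = (m : A) ^ k * D x := by
  rw [← Nat.cast_pow, ← nsmul_eq_mul, map_nsmul, nsmul_eq_mul]

namespace JetDer.PreservesImage

variable {r : ℕ} {D : JetDer f r} {E : EisensteinPoly p} {s : PFun f r}

theorem isOverconvergent_app (hD : D.PreservesImage E) (hs : IsOverconvergent f E r s) :
    IsOverconvergent f E r (D.app s) := by
  obtain ⟨ν, g, hg⟩ := hs
  obtain ⟨h, hh⟩ := hD g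
  refine ⟨ν, h, fun U => ?_⟩
  rw [← hh, hg]
  exact congrArg (1 ⊗ₜ ·) (derivation_natCast_pow_mul (D.der U) p ν (s.1 U))

theorem isTraceOverconvergent_app (hD : D.PreservesImage E)
    (hs : IsTraceOverconvergent f E r s) : IsTraceOverconvergent f E r (D.app s) := by
  obtain ⟨ν, g, hg⟩ := hs
  obtain ⟨h, hh⟩ := hD g
  refine ⟨ν, h, fun U => ?_⟩
  rw [← hh, traceMap_ext, hg]
  exact derivation_natCast_pow_mul (D.der U) p ν (s.1 U)

end JetDer.PreservesImage

end Global

end ArithJet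

end

theorem proposition2p11_general (p : ℕ) [Fact p.Prime] (E : ArithJet.EisensteinPoly p)
    {X : Scheme.{0}} (f : X ⟶ Spec (CommRingCat.of (ArithJet.Rp p))) [Smooth f]
    (d : ArithJet.SheafDer f) (r : ℕ) :
    (∃! D : Fin (r + 1) → ArithJet.JetDer f r, ArithJet.IsConjugate d D) ∧
    ∀ D : Fin (r + 1) → ArithJet.JetDer f r, ArithJet.IsConjugate d D → ∀ j : Fin (r + 1),
      (D j).PreservesImage E ∧
      ∀ s : ArithJet.PFun f r,
        (ArithJet.IsOverconvergent f E r s →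
          ArithJet.IsOverconvergent f E r ((D j).app s)) ∧
        (ArithJet.IsTraceOverconvergent f E r s →
          ArithJet.IsTraceOverconvergent f E r ((D j).app s)) := by
  have hconj := d.isConjugate_conj r
  refine ⟨⟨_, hconj, fun D hD => hD.unique hconj⟩, fun D hD j => ?_⟩
  obtain rfl := hD.unique hconj
  have himage := d.preservesImage_conj E j
  exact ⟨himage, fun s => ⟨himage.isOverconvergent_app, himage.isTraceOverconvergent_app⟩⟩

theorem proposition2p11 (p : ℕ) [Fact p.Prime] (hp : 5 ≤ p) (E : ArithJet.EisensteinPoly p)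
    {X : Scheme.{0}} (f : X ⟶ Spec (CommRingCat.of (ArithJet.Rp p))) [Smooth f]
    (d : ArithJet.SheafDer f) :
    (∀ r : ℕ,
      (∃! D : Fin (r + 1) → ArithJet.JetDer f r, ArithJet.IsConjugate d D) ∧
      ∀ D : Fin (r + 1) → ArithJet.JetDer f r, ArithJet.IsConjugate d D →
        ∀ (s : ArithJet.PFun f r) (j : Fin (r + 1)),
          (ArithJet.IsOverconvergent f E r s →
            ArithJet.IsOverconvergent f E r ((D j).app s)) ∧
          (ArithJet.IsTraceOverconvergent f E r s →
            ArithJet.IsTraceOverconvergent f E r ((D j).app s))) ∧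
    (∀ D : Fin 2 → ArithJet.JetDer f 1, ArithJet.IsConjugate d D →
      ∀ (j : Fin 2) (g : ArithJet.PiFun f E 1), ∃ h : ArithJet.PiFun f E 1,
        ∀ U : X.affineOpens,
          (D j).ext E U (ArithJet.toPJet f E 1 U (g.1 U)) =
            ArithJet.toPJet f E 1 U (h.1 U)) := by
  have main := proposition2p11_general p E f d
  exact ⟨fun r => ⟨(main r).1, fun D hD s j => ((main r).2 D hD j).2 s⟩,
    fun D hD j => ((main 1).2 D hD j).1⟩
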